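/- Let $g_\theta=\mathrm{diag}(e^{i\theta/2},e^{-i\theta/2})\in SU(2)$, let $dz$ be the normalised Haar measure of $SU(2)$, and let $\mathcal H_{inv}=L^2((\mathbb R/2\pi\mathbb Z)^2)$ with $\langle\phi,\psi\rangle=\int_0^{2\pi}\!\int_0^{2\pi}\overline{\phi(\alpha,\beta)}\,\psi(\alpha,\beta)\,d\alpha\,d\beta$, its elements being regarded as functions on $\mathbb R^2$ that are $2\pi$-periodic in both arguments. Kinematical setting. Kinematical states are superpositions of singular elements $a\otimes\delta_b$, $a,b\in SU(2)$. The graph algebra of the torus, with generators $A(v,u),B(v,u)$, $v,u\in SU(2)$, acts on them by $$A(v,u)(a\otimes\delta_b)=\delta_v(ab)\;ua\otimes\delta_{bu^{-1}},\qquad B(v,u)(a\otimes\delta_b)=\delta_v(b^{-1}ab)\;a\otimes\delta_{bu^{-1}},$$ where $\delta_v$ is the delta distribution for the Haar measure. So an element $\int dv\,c(v)\,A(v,\kappa(v))$ acts by $a\otimes\delta_b\mapsto c(ab)\,\kappa(ab)a\otimes\delta_{b\kappa(ab)^{-1}}$, and similarly for $B$. Wilson loops. Let $\mu\in\mathbb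 R$, $s\in\frac12\mathbb Z$, and let $M_s:SU(2)\times SU(2)\to\mathbb R$ be a function with $M_s(x^{-1}ux,x^{-1}vx)=M_s(u,v)$. For $X=A,B$ put $$W_{\mu,s}(X)=\int_{SU(2)}\!dz\int_0^{2\pi}\!d\theta\;M_s(g_\mu,g_\theta)\,e^{is\theta}\,X(zg_\theta z^{-1},zg_\mu z^{-1})\quad(\mu\notin2\pi\mathbb Z),$$ $$W_{\mu,s}(X)=\int_{SU(2)}\!dz\int_{SU(2)}\!dn\;M_s(g_\mu,n)\,\chi_{|s|}(n)\,X(znz^{-1},zg_\mu z^{-1})\quad(\mu\in2\pi\mathbb Z),$$ where $\chi_{|s|}$ is the character of the irreducible representation of $SU(2)$ of spin $|s|$. Action on $\mathcal H_{inv}$. Let $\chi_{\alpha,\beta}=\int_{SU(2)}dz\;zg_\alpha z^{-1}\otimes\delta_{zg_\beta z^{-1}}$. An element $\psi\in\mathcal H_{inv}$ is the coefficient function of the formal expansion $\int d\alpha\int d\beta\;\psi(\alpha+\beta,\alpha)\,\chi_{\alpha,\beta}$. A bounded operator $T$ on $\mathcal H_{inv}$ is called the action of $W_{\mu,s}(X)$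 if $W_{\mu,s}(X)$ is of the form $\int dv\,c(v)X(v,\kappa(v))$ with $c$ integrable and $\kappa$ measurable, and $$W_{\mu,s}(X)\int_D\psi(\alpha+\beta,\alpha)\,\chi_{\alpha,\beta}\,d\alpha\,d\beta=\int_{D'}(T\psi)(\alpha+\beta,\alpha)\,\chi_{\alpha,\beta}\,d\alpha\,d\beta$$ for all $\psi\in\mathcal H_{inv}$ and all bounded measurable sets $D\subset\mathbb R^2$ on which $0<\alpha+\beta<2\pi$ (for $X=A$), respectively $0<\alpha<2\pi$ (for $X=B$). Here $D'$ is the image of $D$ under $(\alpha,\beta)\mapsto(\alpha+\mu,\beta-\mu)$ for $X=A$, and under $(\alpha,\beta)\mapsto(\alpha,\beta-\mu)$ for $X=B$. Let $\mathcal A$ be the unital complex $*$-algebra generated by the Wilson loops $W_{\mu,s}(X)$ (that is, freely generated by these symbols) with the star structure $W_{\mu,s}(X)^*=W_{2\pi-\mu,-s}(X)$. Theorem. There are measurable invariant functions $M_s$, $s\in\frac12\mathbb Z$, such that $M_s(g_\mu,\cdot)$ does not depend on $s$ for $\mu\notin2\pi\mathbb Z$, and a $*$-representation $\pi$ of $\mathcal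 A$ by bounded operators on $\mathcal H_{inv}$ with the following properties. For all $\mu\in\mathbb R$, $s\in\frac12\mathbb Z$ and $X=A,B$ the operator $\pi(W_{\mu,s}(X))$ is the unique action of $W_{\mu,s}(X)$ on $\mathcal H_{inv}$; it is unitary, and $\langle\pi(W_{\mu,s}(X)^*)\phi,\psi\rangle=\langle\phi,\pi(W_{\mu,s}(X))\psi\rangle$ for all $\phi,\psi\in\mathcal H_{inv}$. For every $\psi\in\mathcal H_{inv}$ and almost all $(\alpha,\beta)$, $$\pi(W_{\mu,s}(A))\psi(\alpha,\beta)=w_{\mu,s}(\alpha)\,\psi(\alpha,\beta-\mu),\qquad\pi(W_{\mu,s}(B))\psi(\alpha,\beta)=w_{\mu,s}(\beta)\,\psi(\alpha+\mu,\beta),$$ where $w_{\mu,s}$ is the $2\pi$-periodic function with $w_{\mu,s}(\gamma)=e^{is\gamma}$ for $\gamma\in[0,2\pi)$ if $\mu\notin2\pi\mathbb Z$, and $w_{\mu,s}=1$ if $\mu\in2\pi\mathbb Z$. -/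

import Mathlib

open MeasureTheory Set

/-! ### The group `SU(2)` -/

/-- The group `SU(2)`, with the topology and the Borel structure of a set of matrices. -/
abbrev SU2 : Type := Matrix.specialUnitaryGroup (Fin 2) ℂ

namespace SU2

instance : ContinuousInv SU2 where
  continuous_inv := by
    refine Continuous.subtype_mk ?_ _
    exact continuous_star.comp continuous_subtype_val

instance : IsTopologicalGroup SU2 where

noncomputable instance : MeasurableSpace SU2 := borel SU2

instance : BorelSpace SU2 := ⟨rfl⟩

theorem norm_entry_le_one (u : SU2) (i j : Fin 2) : ‖(u : Matrix (Fin 2) (Fin 2) ℂ) i j‖ ≤ 1 :=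
  entry_norm_bound_of_unitary (Matrix.mem_specialUnitaryGroup_iff.mp u.2).1 i j

instance : CompactSpace SU2 := by
  refine isCompact_iff_compactSpace.mp ?_
  have hK := isCompact_univ_pi (fun _ : Fin 2 =>
    isCompact_univ_pi (fun _ : Fin 2 => isCompact_closedBall (0 : ℂ) 1))
  refine hK.of_isClosed_subset ?_ ?_
  · have : (Matrix.specialUnitaryGroup (Fin 2) ℂ : Set (Matrix (Fin 2) (Fin 2) ℂ))
        = {A | A * star A = 1} ∩ {A | A.det = 1} := by
      ext A
      simp [Matrix.mem_specialUnitaryGroup_iff, Matrix.mem_unitaryGroup_iff]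
    rw [this]
    refine IsClosed.inter ?_ ?_
    · exact isClosed_eq (continuous_id.matrix_mul continuous_star) continuous_const
    · exact isClosed_eq (Continuous.matrix_det continuous_id) continuous_const
  · intro A hA i _ j _
    simpa using norm_entry_le_one ⟨A, hA⟩ i j

/-- The normalised Haar measure of `SU(2)`. -/
noncomputable def haar : Measure SU2 := Measure.haarMeasure ⊤

/-- The diagonal element `g_θ = exp (θ J₀) = diag (e^{iθ/2}, e^{-iθ/2})`. -/
noncomputable def g (θ : ℝ) : SU2 :=
  ⟨!![Complex.exp (Complex.I * θ / 2), 0; 0, Complex.exp (-(Complex.I * θ / 2))], by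
    have h1 : (starRingEnd ℂ) (Complex.exp (Complex.I * θ / 2))
        = Complex.exp (-(Complex.I * θ / 2)) := by
      rw [← Complex.exp_conj]; simp [neg_div, map_ofNat]
    have h2 : (starRingEnd ℂ) (Complex.exp (-(Complex.I * θ / 2)))
        = Complex.exp (Complex.I * θ / 2) := by
      rw [← Complex.exp_conj]; simp [neg_div, map_ofNat]
    rw [Matrix.mem_specialUnitaryGroup_iff, Matrix.mem_unitaryGroup_iff]
    refine ⟨?_, ?_⟩
    · ext i j
      fin_cases i <;> fin_cases j <;>
        simp [Matrix.mul_apply, Fin.sum_univ_two, Matrix.star_apply, h1, h2, ← Complex.exp_add]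
    · simp [Matrix.det_fin_two, ← Complex.exp_add]⟩

/-- The character of the irreducible representation of `SU(2)` of dimension `n + 1`
(that is, of spin `n / 2`): its value on the class of `g_θ` is `sin ((n+1) θ/2) / sin (θ/2)`,
a Chebyshev polynomial of the second kind in half of the trace. -/
noncomputable def character (n : ℕ) (u : SU2) : ℝ :=
  (Polynomial.Chebyshev.U ℝ n).eval ((Matrix.trace (u : Matrix (Fin 2) (Fin 2) ℂ)).re / 2)

theorem character_g (n : ℕ) (θ : ℝ) :
    character n (g θ) * Real.sin (θ / 2) = Real.sin ((n + 1) * (θ / 2)) := by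
  have h : (Matrix.trace (g θ : Matrix (Fin 2) (Fin 2) ℂ)).re / 2 = Real.cos (θ / 2) := by
    simp [g, Matrix.trace_fin_two, Complex.exp_re]
  have h2 := Polynomial.Chebyshev.U_real_cos (θ / 2) (n : ℤ)
  rw [character, h]
  exact_mod_cast h2

end SU2

/-! ### The algebra generated by the Wilson loops and its star structure -/

/-- The two generators (`a`- and `b`-cycle) of the fundamental group of the torus, to which the
generators `A` and `B` of the graph algebra belong. -/
inductive TorusCycle : Type
  | A
  | B

/-- Labels of the Wilson loops `W_{μ,s}(X)`; the half-integer `s` is stored as `twoS = 2 s`. -/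
@[ext]
structure WilsonLabel : Type where
  X : TorusCycle
  μ : ℝ
  twoS : ℤ

namespace WilsonLabel

/-- The spin `s`, an element of `½ ℤ`. -/
noncomputable def s (l : WilsonLabel) : ℝ := (l.twoS : ℝ) / 2

/-- The label of `W_{μ,s}(X)^* = W_{2π-μ,-s}(X)`. -/
noncomputable def conj (l : WilsonLabel) : WilsonLabel := ⟨l.X, 2 * Real.pi - l.μ, -l.twoS⟩

theorem conj_conj (l : WilsonLabel) : l.conj.conj = l := by
  ext <;> simp [conj]

end WilsonLabel

/-- The associative unital complex algebra generated by the Wilson loops. -/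
abbrev WilsonAlgebra : Type := MonoidAlgebra ℂ (FreeMonoid WilsonLabel)

namespace WilsonAlgebra

/-- The generator `W_{μ,s}(X)`. -/
noncomputable def W (l : WilsonLabel) : WilsonAlgebra := MonoidAlgebra.single (FreeMonoid.of l) 1

/-- The conjugate linear antihomomorphism with `W_{μ,s}(X) ↦ W_{2π-μ,-s}(X)`. -/
noncomputable def starHom : WilsonAlgebra →+* WilsonAlgebraᵐᵒᵖ :=
  MonoidAlgebra.liftNCRingHom
    ((algebraMap ℂ WilsonAlgebraᵐᵒᵖ).comp (starRingEnd ℂ))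
    (FreeMonoid.lift fun l => MulOpposite.op (W l.conj) : FreeMonoid WilsonLabel →* WilsonAlgebraᵐᵒᵖ)
    (fun r _ => Algebra.commutes ((starRingEnd ℂ) r) _)

theorem starHom_W (l : WilsonLabel) : starHom (W l) = MulOpposite.op (W l.conj) := by
  simp [starHom, W, MonoidAlgebra.liftNCRingHom, ← MonoidAlgebra.one_def]

theorem starHom_smul (c : ℂ) (a : WilsonAlgebra) :
    starHom (c • a) = (starRingEnd ℂ) c • starHom a := by
  have h : starHom (algebraMap ℂ WilsonAlgebra c)
      = algebraMap ℂ WilsonAlgebraᵐᵒᵖ ((starRingEnd ℂ) c) := by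
    simp [starHom, MonoidAlgebra.liftNCRingHom]
  rw [Algebra.smul_def, map_mul, h, ← Algebra.smul_def]

/-- Every element is built from the generators by the algebra operations. -/
theorem induction {p : WilsonAlgebra → Prop} (h1 : p 1) (hW : ∀ l, p (W l))
    (hadd : ∀ a b, p a → p b → p (a + b)) (hmul : ∀ a b, p a → p b → p (a * b))
    (hsmul : ∀ (c : ℂ) a, p a → p (c • a)) (a : WilsonAlgebra) : p a := by
  refine MonoidAlgebra.induction_on a ?_ hadd hsmul
  intro w
  induction w using FreeMonoid.recOn with
  | one => exact h1
  | of_mul l w ih => rw [map_mul]; exact hmul _ _ (hW l) ih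

/-- The star structure `W_{μ,s}(X)^* = W_{2π-μ,-s}(X)`. -/
noncomputable instance : StarRing WilsonAlgebra where
  star a := (starHom a).unop
  star_involutive a := by
    refine induction (p := fun a => (starHom (starHom a).unop).unop = a) ?_ ?_ ?_ ?_ ?_ a
    · simp
    · intro l; simp [starHom_W, WilsonLabel.conj_conj]
    · intro a b ha hb; simp [ha, hb]
    · intro a b ha hb; simp [ha, hb]
    · intro c a ha; simp [starHom_smul, ha]
  star_mul a b := by simp
  star_add a b := by simp

theorem star_W (l : WilsonLabel) : star (W l) = W l.conj := by
  change (starHom (W l)).unop = _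
  rw [starHom_W, MulOpposite.unop_op]

noncomputable instance : StarModule ℂ WilsonAlgebra where
  star_smul c a := by
    change (starHom (c • a)).unop = (starRingEnd ℂ) c • (starHom a).unop
    rw [starHom_smul, MulOpposite.unop_smul]

end WilsonAlgebra

/-! ### The gauge invariant Hilbert space -/

instance twoPiPos : Fact (0 < 2 * Real.pi) := ⟨Real.two_pi_pos⟩

/-- The circle `ℝ / 2πℤ`; its measure `volume` has total mass `2π`. -/
abbrev Circle2Pi : Type := AddCircle (2 * Real.pi)

/-- The gauge invariant Hilbert space: `L²` functions on the torus, with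
`⟨φ, ψ⟩ = ∫₀^{2π} ∫₀^{2π} conj (φ (α, β)) ψ (α, β) dα dβ`. -/
abbrev Hinv : Type := Lp ℂ 2 (volume : Measure (Circle2Pi × Circle2Pi))

/-- The value at `(α, β)` of the doubly `2π`-periodic function on `ℝ²` given by `ψ ∈ Hinv`. -/
noncomputable def Hinv.val (ψ : Hinv) (α β : ℝ) : ℂ := ψ ((α : Circle2Pi), (β : Circle2Pi))

/-! ### Wilson loops -/

/-- `μ ∈ 2πℤ`. -/
def IsSingular (μ : ℝ) : Prop := ∃ m : ℤ, μ = 2 * Real.pi * m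

open Classical in
/-- The Wilson loop `W_{μ,s}(X) = ∫ dz ∫_{N_μ} dn M(g_μ, n) χ^s_{N_μ}(n) X(z n z⁻¹, z g_μ z⁻¹)` for a
density `M`. As a superposition of the generators `X(v,u)` of the graph algebra it is given by its
coefficient distribution, that is, by its pairing with test functions `F(v,u)`. For `μ ∉ 2πℤ` the
centraliser `N_μ` of `g_μ` is the circle of the `g_θ`, the characters are `e^{isθ}` and `∫ dn` is
`∫₀^{2π} dθ`; for `μ ∈ 2πℤ` the centraliser is `SU(2)` and the characters are those of spin `|s|`. -/
noncomputable def wilsonLoop (M : SU2 → SU2 → ℝ) (μ : ℝ) (twoS : ℤ) (F : SU2 → SU2 → ℂ) : ℂ :=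
  if IsSingular μ then
    ∫ z, (∫ n, ((M (SU2.g μ) n * SU2.character twoS.natAbs n : ℝ) : ℂ)
      * F (z * n * z⁻¹) (z * SU2.g μ * z⁻¹) ∂SU2.haar) ∂SU2.haar
  else
    ∫ z, (∫ θ in (0 : ℝ)..(2 * Real.pi), (M (SU2.g μ) (SU2.g θ) : ℂ)
      * Complex.exp (Complex.I * ((twoS : ℝ) / 2 : ℝ) * θ)
      * F (z * SU2.g θ * z⁻¹) (z * SU2.g μ * z⁻¹)) ∂SU2.haar

/-- A coefficient distribution `L` is `c(v) δ_{κ(v)}(u)`: the element of the graph algebra that it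
describes is `∫ dv c(v) X(v, κ(v))`, with `dv` the Haar measure. -/
def HasSymbol (L : (SU2 → SU2 → ℂ) → ℂ) (c : SU2 → ℂ) (κ : SU2 → SU2) : Prop :=
  Integrable c SU2.haar ∧ Measurable κ ∧
    ∀ F : SU2 → SU2 → ℂ, Continuous (fun p : SU2 × SU2 => F p.1 p.2) →
      L F = ∫ v, c v * F v (κ v) ∂SU2.haar

/-! ### Kinematical states and the representation of the graph algebra -/

/-- Kinematical states: superpositions of the singular elements `a ⊗ δ_b`, given by their pairing
with test functions on `SU(2) × SU(2)`; the element `a ⊗ δ_b` is evaluation at `(a, b)`. -/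
abbrev KinState : Type := (SU2 → SU2 → ℂ) → ℂ

/-- The gauge invariant state `χ_{α,β} = ∫ dz (z g_α z⁻¹) ⊗ δ_{z g_β z⁻¹}`. -/
noncomputable def chi (α β : ℝ) : KinState := fun h =>
  ∫ z, h (z * SU2.g α * z⁻¹) (z * SU2.g β * z⁻¹) ∂SU2.haar

/-- The part over `D` of the expansion `ψ = ∫ dα ∫ dβ ψ(α+β, α) χ_{α,β}`. -/
noncomputable def stateOn (D : Set (ℝ × ℝ)) (ψ : Hinv) : KinState := fun h =>
  ∫ p in D, ψ.val (p.1 + p.2) p.1 * chi p.1 p.2 h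

/-- The action of `∫ dv c(v) X(v, κ(v))` on kinematical states in the representation
`A(v,u) (a ⊗ δ_b) = δ_v(ab) (u a ⊗ δ_{b u⁻¹})`, `B(v,u) (a ⊗ δ_b) = δ_v(b⁻¹ a b) (a ⊗ δ_{b u⁻¹})`
of the graph algebra. -/
def graphAction (X : TorusCycle) (c : SU2 → ℂ) (κ : SU2 → SU2) (Φ : KinState) : KinState := fun h =>
  match X with
  | TorusCycle.A => Φ fun a b => c (a * b) * h (κ (a * b) * a) (b * (κ (a * b))⁻¹)
  | TorusCycle.B => Φ fun a b => c (b⁻¹ * a * b) * h a (b * (κ (b⁻¹ * a * b))⁻¹)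

/-- The parameters `(α, β)` for which the class angle seen by `X` (`α + β` for `A`, `α` for `B`) lies
in the fundamental range `(0, 2π)` of conjugacy classes of `SU(2)`. -/
def principal (X : TorusCycle) : Set (ℝ × ℝ) :=
  match X with
  | TorusCycle.A => {p | p.1 + p.2 ∈ Ioo 0 (2 * Real.pi)}
  | TorusCycle.B => {p | p.1 ∈ Ioo 0 (2 * Real.pi)}

/-- The displacement of `(α, β)` by a Wilson loop with mass `μ`. -/
def displace (X : TorusCycle) (μ : ℝ) (p : ℝ × ℝ) : ℝ × ℝ :=
  match X with
  | TorusCycle.A => (p.1 + μ, p.2 - μ)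
  | TorusCycle.B => (p.1, p.2 - μ)

/-- `T` is the action of the Wilson loop `l` (with density `M`) on coefficient functions: on every
bounded piece of the expansion of a state over the principal range, the Wilson loop acts on the
kinematical states as `T` acts on the coefficient functions. -/
def IsWilsonAction (M : SU2 → SU2 → ℝ) (l : WilsonLabel) (T : Hinv →L[ℂ] Hinv) : Prop :=
  ∃ (c : SU2 → ℂ) (κ : SU2 → SU2), HasSymbol (wilsonLoop M l.μ l.twoS) c κ ∧
    ∀ (ψ : Hinv) (D : Set (ℝ × ℝ)), MeasurableSet D → Bornology.IsBounded D → D ⊆ principal l.X →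
      ∀ h : SU2 → SU2 → ℂ, Continuous (fun p : SU2 × SU2 => h p.1 p.2) →
        graphAction l.X c κ (stateOn D ψ) h = stateOn (displace l.X l.μ '' D) (T ψ) h

/-!
The key fact is the Weyl integration formula for `SU(2)` (`SU2.measurePreserving_conj_g`): Haar
measure is the image of `dz ⊗ π⁻¹ sin² (θ/2) dθ`, `0 < θ < 2π`, under `(z, θ) ↦ z g_θ z⁻¹`.
Averaging over conjugacy classes reduces it to the law of half of the trace. Invariance of Haar
measure under `v ↦ g_t v g_t`, differentiated at `t = 0`, gives a recursion for the moments of this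
law (`SU2.integral_re_pow_succ`, `SU2.integral_re_pow_mul_im_sq`); integration by parts gives the
same recursion for the semicircle law, and polynomials are dense.

The density of the Wilson loops is chosen to be the Weyl density when `g_μ` is not central, and the
inverse of the character of spin `|s|` when it is. By Weyl's formula, `W_{μ,s}(X)` then has a symbol
`(c, κ)` with `c = e^{isθ}` (or `1`) and `κ = z g_μ z⁻¹` at `v = z g_θ z⁻¹`
(`hasSymbol_wilsonLoop`). Since `c` does not vanish, testing against continuous functions shows
that every symbol agrees with this one almost everywhere (`HasSymbol.ae_eq`), hence, by Weyl's
formula again, on almost every conjugacy class (`HasSymbol.ae_conj_g`).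

The holonomies `ab` and `b⁻¹ab` of the state `χ_{α,β}` have class angle `α + β` and `α`. So on the
principal range any symbol multiplies `χ_{α,β}` by a phase of that angle and displaces `(α, β)`; in
the arguments `(α + β, α)` of the coefficient function this is a translation of the torus followed
by multiplication with a phase (`graphAction_stateOn`). These operators are unitary, the adjoint
being given by the conjugate label (`WilsonLabel.star_op`), so they define a `*`-representation of
the free algebra. An action is unique because a coefficient function can be recovered from the total
weights of pieces of its expansion, and the displaced pieces of the principal range cover the torus
up to a null set (`Hinv.ext_of_stateOn`).
-/

namespace SU2

/-! ### Coordinates and topology of `SU(2)` -/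

instance : SecondCountableTopology SU2 := by
  have : SecondCountableTopology (Matrix (Fin 2) (Fin 2) ℂ) :=
    inferInstanceAs (SecondCountableTopology (Fin 2 → Fin 2 → ℂ))
  exact Topology.IsInducing.subtypeVal.secondCountableTopology

instance : TopologicalSpace.PseudoMetrizableSpace SU2 := by
  have : TopologicalSpace.PseudoMetrizableSpace (Matrix (Fin 2) (Fin 2) ℂ) :=
    inferInstanceAs (TopologicalSpace.PseudoMetrizableSpace (Fin 2 → Fin 2 → ℂ))
  exact Topology.IsInducing.subtypeVal.pseudoMetrizableSpace

instance : HasOuterApproxClosed SU2 := by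
  let := TopologicalSpace.pseudoMetrizableSpacePseudoMetric SU2
  infer_instance

theorem continuous_entry (i j : Fin 2) :
    Continuous fun v : SU2 => (v : Matrix (Fin 2) (Fin 2) ℂ) i j :=
  continuous_subtype_val.matrix_elem i j

theorem continuous_g : Continuous g := by
  refine Continuous.subtype_mk ?_ _
  refine continuous_matrix fun i j => ?_
  fin_cases i <;> fin_cases j <;> simp <;> fun_prop

theorem star_coe_eq (v : SU2) :
    star (v : Matrix (Fin 2) (Fin 2) ℂ) = Matrix.adjugate (v : Matrix (Fin 2) (Fin 2) ℂ) := by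
  obtain ⟨h1, h2⟩ := Matrix.mem_specialUnitaryGroup_iff.mp v.2
  have h3 := Matrix.mem_unitaryGroup_iff'.mp h1
  calc star (v : Matrix (Fin 2) (Fin 2) ℂ)
      = star (v : Matrix (Fin 2) (Fin 2) ℂ)
          * ((v : Matrix (Fin 2) (Fin 2) ℂ) * Matrix.adjugate (v : Matrix (Fin 2) (Fin 2) ℂ)) := by
        rw [Matrix.mul_adjugate, h2, one_smul, mul_one]
    _ = _ := by rw [← mul_assoc, h3, one_mul]

theorem entry_one_one (v : SU2) :
    (v : Matrix (Fin 2) (Fin 2) ℂ) 1 1 = star ((v : Matrix (Fin 2) (Fin 2) ℂ) 0 0) := by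
  have := congrFun (congrFun (star_coe_eq v) 0) 0
  simpa [Matrix.adjugate_fin_two, Matrix.star_apply] using this.symm

theorem entry_one_zero (v : SU2) :
    (v : Matrix (Fin 2) (Fin 2) ℂ) 1 0 = -star ((v : Matrix (Fin 2) (Fin 2) ℂ) 0 1) := by
  have := congrFun (congrFun (star_coe_eq v) 1) 0
  simp only [Matrix.adjugate_fin_two, Matrix.star_apply] at this
  simp [this]

theorem normSq_add_normSq (v : SU2) :
    Complex.normSq ((v : Matrix (Fin 2) (Fin 2) ℂ) 0 0)
      + Complex.normSq ((v : Matrix (Fin 2) (Fin 2) ℂ) 0 1) = 1 := by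
  have h := (Matrix.mem_specialUnitaryGroup_iff.mp v.2).2
  rw [Matrix.det_fin_two, entry_one_one, entry_one_zero] at h
  have h2 := congrArg Complex.re h
  simp at h2
  simp [Complex.normSq_apply]
  linarith

/-- The element of `SU(2)` with first row `(a, b)`. -/
def ofRow (a b : ℂ) (h : Complex.normSq a + Complex.normSq b = 1) : SU2 :=
  ⟨!![a, b; -star b, star a], by
    have h' : a * (starRingEnd ℂ) a + b * (starRingEnd ℂ) b = 1 := by
      rw [Complex.mul_conj, Complex.mul_conj]; exact_mod_cast h
    rw [Matrix.mem_specialUnitaryGroup_iff, Matrix.mem_unitaryGroup_iff]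
    refine ⟨?_, ?_⟩
    · ext i j
      fin_cases i <;> fin_cases j <;>
        simp [Matrix.mul_apply, Fin.sum_univ_two, Matrix.star_apply]
      · exact h'
      · ring
      · ring
      · linear_combination h'
    · simp [Matrix.det_fin_two]
      exact h'⟩

theorem coe_inv (v : SU2) : ((v⁻¹ : SU2) : Matrix (Fin 2) (Fin 2) ℂ)
    = star (v : Matrix (Fin 2) (Fin 2) ℂ) := rfl

theorem g_add (s t : ℝ) : g (s + t) = g s * g t := by
  ext i j
  fin_cases i <;> fin_cases j <;>
    simp [g, ← Complex.exp_add]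
  all_goals congr 1; ring

theorem g_zero : g 0 = 1 := by
  ext i j
  fin_cases i <;> fin_cases j <;> simp [g]

theorem g_neg (t : ℝ) : g (-t) = (g t)⁻¹ := by
  rw [eq_inv_iff_mul_eq_one, ← g_add, neg_add_cancel, g_zero]

/-- Half of the trace of an element of `SU(2)`, a number in `[-1, 1]`. -/
noncomputable def halfTrace (v : SU2) : ℝ :=
  (Matrix.trace (v : Matrix (Fin 2) (Fin 2) ℂ)).re / 2

theorem halfTrace_eq_re (v : SU2) :
    halfTrace v = ((v : Matrix (Fin 2) (Fin 2) ℂ) 0 0).re := by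
  rw [halfTrace, Matrix.trace_fin_two, entry_one_one]
  simp

theorem continuous_halfTrace : Continuous halfTrace := by
  simp only [funext halfTrace_eq_re]
  exact Complex.continuous_re.comp (continuous_entry 0 0)

theorem abs_halfTrace_le_one (v : SU2) : |halfTrace v| ≤ 1 := by
  rw [halfTrace_eq_re]
  exact (Complex.abs_re_le_norm _).trans (norm_entry_le_one v 0 0)

theorem halfTrace_mem_Icc (v : SU2) : halfTrace v ∈ Icc (-1 : ℝ) 1 :=
  abs_le.mp (abs_halfTrace_le_one v)

theorem halfTrace_conj (z v : SU2) : halfTrace (z * v * z⁻¹) = halfTrace v := by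
  have h := Matrix.mem_unitaryGroup_iff'.mp (Matrix.mem_specialUnitaryGroup_iff.mp z.2).1
  simp only [halfTrace, Submonoid.coe_mul, coe_inv]
  rw [Matrix.trace_mul_cycle, h, one_mul]

theorem halfTrace_g (θ : ℝ) : halfTrace (g θ) = Real.cos (θ / 2) := by
  simp [halfTrace, g, Matrix.trace_fin_two, Complex.exp_re]

/-- Every element of `SU(2)` is conjugate to the diagonal element with the same trace: the columns
of the conjugating matrix are unit eigenvectors. -/
theorem exists_conj_g (v : SU2) : ∃ z : SU2, v = z * g (2 * Real.arccos (halfTrace v)) * z⁻¹ := by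
  set a := (v : Matrix (Fin 2) (Fin 2) ℂ) 0 0 with ha
  set b := (v : Matrix (Fin 2) (Fin 2) ℂ) 0 1 with hb
  set θ := 2 * Real.arccos (halfTrace v) with hθ
  set e := Complex.exp (Complex.I * θ / 2) with he
  have hcos : Real.cos (θ / 2) = a.re := by
    rw [hθ, mul_div_cancel_left₀ _ two_ne_zero,
      Real.cos_arccos (halfTrace_mem_Icc v).1 (halfTrace_mem_Icc v).2, halfTrace_eq_re]
  have hinv : Complex.exp (-(Complex.I * θ / 2)) = star e := by
    rw [he, Complex.star_def, ← Complex.exp_conj]; simp [neg_div, map_ofNat]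
  have hee : e * star e = 1 := by
    rw [← hinv, he, ← Complex.exp_add]; simp
  have hsum : e + star e = 2 * (a.re : ℂ) := by
    rw [Complex.star_def, Complex.add_conj, ← hcos]
    simp [he, Complex.exp_re]
  have hab : a * star a + b * star b = 1 := by
    rw [Complex.star_def, Complex.mul_conj, Complex.mul_conj]
    exact_mod_cast normSq_add_normSq v
  have hasum : a + star a = 2 * (a.re : ℂ) := by
    rw [Complex.star_def, Complex.add_conj]; push_cast; ring
  have hv : (v : Matrix (Fin 2) (Fin 2) ℂ) = !![a, b; -star b, star a] := by
    ext i j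
    fin_cases i <;> fin_cases j
    · rfl
    · rfl
    · exact entry_one_zero v
    · exact entry_one_one v
  have hg : (g θ : Matrix (Fin 2) (Fin 2) ℂ) = !![e, 0; 0, star e] := by
    rw [← hinv]; rfl
  suffices h : ∃ z : SU2, v * z = z * g θ by
    obtain ⟨z, hz⟩ := h
    exact ⟨z, by rw [← hz, mul_inv_cancel_right]⟩
  -- `(b, e - a)` is an eigenvector of `v` for the eigenvalue `e`, unless it vanishes.
  by_cases hw : Complex.normSq b + Complex.normSq (e - a) = 0
  · have hb0 : b = 0 := by
      rw [← Complex.normSq_eq_zero]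
      linarith [Complex.normSq_nonneg b, Complex.normSq_nonneg (e - a)]
    have ha0 : e = a := by
      rw [← sub_eq_zero, ← Complex.normSq_eq_zero]
      linarith [Complex.normSq_nonneg b, Complex.normSq_nonneg (e - a)]
    refine ⟨1, ?_⟩
    rw [mul_one, one_mul]
    apply Subtype.ext
    rw [hv, hg, ha0, hb0]; simp
  · set N := Real.sqrt (Complex.normSq b + Complex.normSq (e - a)) with hN
    have hpos : 0 < Complex.normSq b + Complex.normSq (e - a) :=
      lt_of_le_of_ne (add_nonneg (Complex.normSq_nonneg _) (Complex.normSq_nonneg _)) (Ne.symm hw)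
    have hN2 : N ^ 2 = Complex.normSq b + Complex.normSq (e - a) := Real.sq_sqrt hpos.le
    refine ⟨ofRow (b * (N⁻¹ : ℝ)) (-star ((e - a) * (N⁻¹ : ℝ))) ?_, ?_⟩
    · rw [Complex.normSq_neg, Complex.star_def, Complex.normSq_conj, map_mul, map_mul, ← add_mul,
        Complex.normSq_ofReal, ← hN2]
      have : N ≠ 0 := by rw [hN]; exact (Real.sqrt_pos.mpr hpos).ne'
      field_simp
    · -- The second row of the eigenvalue equation is the characteristic equation of `v` at `e`.
      have h1 : -(star b * b) + star a * (e - a) = (e - a) * e := by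
        linear_combination hee - hab - e * hsum + e * hasum
      have h1' := congrArg star h1
      simp only [star_add, star_neg, star_mul', star_star, star_sub] at h1'
      apply Subtype.ext
      rw [Submonoid.coe_mul, Submonoid.coe_mul, hv, hg]
      ext i j
      fin_cases i <;> fin_cases j <;>
        simp only [ofRow, Matrix.mul_apply, Fin.sum_univ_two, Matrix.of_apply, Matrix.cons_val',
          Matrix.cons_val_zero, Matrix.cons_val_one, Fin.zero_eta, Fin.mk_one, star_neg,
          star_mul', star_sub, Complex.star_def, Complex.conj_ofReal, Complex.conj_conj,
          Matrix.cons_val_fin_one]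
      · ring
      · simp only [Complex.star_def] at h1' hasum hsum hab hee ⊢
        linear_combination (-(N⁻¹ : ℝ) : ℂ) * h1'
      · simp only [Complex.star_def] at h1 hasum hsum hab hee ⊢
        linear_combination ((N⁻¹ : ℝ) : ℂ) * h1
      · ring

/-! ### Haar measure -/

instance : haar.IsHaarMeasure := by unfold haar; infer_instance

instance : IsProbabilityMeasure haar :=
  ⟨by rw [haar, ← TopologicalSpace.PositiveCompacts.coe_top]; exact Measure.haarMeasure_self⟩

instance : haar.IsMulRightInvariant where
  map_mul_right_eq_self y := by
    have : IsProbabilityMeasure (haar.map (· * y)) :=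
      Measure.isProbabilityMeasure_map (measurable_mul_const y).aemeasurable
    exact Measure.isHaarMeasure_eq_of_isProbabilityMeasure _ _

theorem integral_mul_mul {E : Type*} [NormedAddCommGroup E] [NormedSpace ℝ E] (p q : SU2)
    (f : SU2 → E) : ∫ v, f (p * v * q) ∂haar = ∫ v, f v ∂haar := by
  rw [integral_mul_left_eq_self (fun v => f (v * q)) p, integral_mul_right_eq_self f q]

theorem integrable_of_continuous {E : Type*} [NormedAddCommGroup E] {f : SU2 → E}
    (hf : Continuous f) : Integrable f haar :=
  hf.integrable_of_hasCompactSupport (HasCompactSupport.of_compactSpace f)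

/-! ### The distribution of the trace under Haar measure -/

theorem g_mul_mul_g_entry (t : ℝ) (v : SU2) :
    ((g t * v * g t : SU2) : Matrix (Fin 2) (Fin 2) ℂ) 0 0
      = Complex.exp (Complex.I * t) * (v : Matrix (Fin 2) (Fin 2) ℂ) 0 0 := by
  have : Complex.exp (Complex.I * t)
      = Complex.exp (Complex.I * t / 2) * Complex.exp (Complex.I * t / 2) := by
    rw [← Complex.exp_add]; congr 1; ring
  rw [this]
  simp only [Submonoid.coe_mul, Matrix.mul_apply, Fin.sum_univ_two]
  simp [g]
  ring

theorem g_mul_mul_inv_g_entry (t : ℝ) (v : SU2) :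
    ((g t * v * (g t)⁻¹ : SU2) : Matrix (Fin 2) (Fin 2) ℂ) 0 1
      = Complex.exp (Complex.I * t) * (v : Matrix (Fin 2) (Fin 2) ℂ) 0 1 := by
  have : Complex.exp (Complex.I * t)
      = Complex.exp (Complex.I * t / 2) * Complex.exp (Complex.I * t / 2) := by
    rw [← Complex.exp_add]; congr 1; ring
  rw [this, ← g_neg]
  simp only [Submonoid.coe_mul, Matrix.mul_apply, Fin.sum_univ_two]
  simp [g, neg_div]
  ring

/-- Invariance of Haar measure under `v ↦ g_t v g_t`, which rotates the complex number `v₀₀` by the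
angle `t`. -/
theorem integral_rotate (n : ℕ) (t : ℝ) :
    ∫ v : SU2, (Real.cos t * ((v : Matrix (Fin 2) (Fin 2) ℂ) 0 0).re
        - Real.sin t * ((v : Matrix (Fin 2) (Fin 2) ℂ) 0 0).im) ^ n
      * (Real.sin t * ((v : Matrix (Fin 2) (Fin 2) ℂ) 0 0).re
        + Real.cos t * ((v : Matrix (Fin 2) (Fin 2) ℂ) 0 0).im) ∂haar
      = ∫ v : SU2, ((v : Matrix (Fin 2) (Fin 2) ℂ) 0 0).re ^ n
        * ((v : Matrix (Fin 2) (Fin 2) ℂ) 0 0).im ∂haar := by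
  rw [← integral_mul_mul (g t) (g t) fun v : SU2 => ((v : Matrix (Fin 2) (Fin 2) ℂ) 0 0).re ^ n
    * ((v : Matrix (Fin 2) (Fin 2) ℂ) 0 0).im]
  refine integral_congr_ae (Filter.Eventually.of_forall fun v => ?_)
  have hre : (Complex.exp (Complex.I * t)).re = Real.cos t := by simp [Complex.exp_re]
  have him : (Complex.exp (Complex.I * t)).im = Real.sin t := by simp [Complex.exp_im]
  simp only [g_mul_mul_g_entry, Complex.mul_re, Complex.mul_im, hre, him]
  ring

/-- The infinitesimal form of the invariance of Haar measure under `v ↦ g_t v g_t`. -/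
theorem integral_re_pow_succ (n : ℕ) :
    ∫ v : SU2, ((v : Matrix (Fin 2) (Fin 2) ℂ) 0 0).re ^ (n + 1) ∂haar
      = n * ∫ v : SU2, ((v : Matrix (Fin 2) (Fin 2) ℂ) 0 0).re ^ (n - 1)
        * ((v : Matrix (Fin 2) (Fin 2) ℂ) 0 0).im ^ 2 ∂haar := by
  have hc : Continuous fun v : SU2 => ((v : Matrix (Fin 2) (Fin 2) ℂ) 0 0).re :=
    Complex.continuous_re.comp (continuous_entry 0 0)
  have hd : Continuous fun v : SU2 => ((v : Matrix (Fin 2) (Fin 2) ℂ) 0 0).im :=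
    Complex.continuous_im.comp (continuous_entry 0 0)
  set x : SU2 → ℝ := fun v => ((v : Matrix (Fin 2) (Fin 2) ℂ) 0 0).re with hx
  set y : SU2 → ℝ := fun v => ((v : Matrix (Fin 2) (Fin 2) ℂ) 0 0).im with hy
  let F : ℝ → SU2 → ℝ := fun t v =>
    (Real.cos t * x v - Real.sin t * y v) ^ n * (Real.sin t * x v + Real.cos t * y v)
  let F' : ℝ → SU2 → ℝ := fun t v =>
    (n * (Real.cos t * x v - Real.sin t * y v) ^ (n - 1)
        * (-Real.sin t * x v - Real.cos t * y v)) * (Real.sin t * x v + Real.cos t * y v)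
      + (Real.cos t * x v - Real.sin t * y v) ^ n * (Real.cos t * x v + -Real.sin t * y v)
  have hFt : ∀ t, Continuous (F t) := fun t => by fun_prop
  have hF'c : Continuous fun p : ℝ × SU2 => F' p.1 p.2 := by fun_prop
  obtain ⟨C, hC⟩ := (isCompact_Icc.prod isCompact_univ :
    IsCompact (Icc (-1 : ℝ) 1 ×ˢ (univ : Set SU2))).exists_bound_of_continuousOn hF'c.continuousOn
  have hder : ∀ v t, HasDerivAt (fun t => F t v) (F' t v) t := fun v t => by
    have h1 := ((Real.hasDerivAt_cos t).mul_const (x v)).sub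
      ((Real.hasDerivAt_sin t).mul_const (y v))
    have h2 := ((Real.hasDerivAt_sin t).mul_const (x v)).add
      ((Real.hasDerivAt_cos t).mul_const (y v))
    exact (h1.pow n).mul h2
  have key := (hasDerivAt_integral_of_dominated_loc_of_deriv_le (μ := haar) (F := F) (F' := F')
    (x₀ := (0 : ℝ)) (bound := fun _ => C) (Icc_mem_nhds (by norm_num) (by norm_num))
    (Filter.Eventually.of_forall fun t => (hFt t).aestronglyMeasurable)
    (integrable_of_continuous (hFt 0))
    (hF'c.comp (Continuous.prodMk_right (0 : ℝ))).aestronglyMeasurable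
    (Filter.Eventually.of_forall fun v t ht => hC (t, v) ⟨ht, mem_univ _⟩)
    (integrable_const C)
    (Filter.Eventually.of_forall fun v t _ => hder v t)).2
  have hconst : (fun t => ∫ v, F t v ∂haar) = fun _ => ∫ v, x v ^ n * y v ∂haar :=
    funext fun t => integral_rotate n t
  rw [hconst] at key
  have h0 := key.unique (hasDerivAt_const (0 : ℝ) _)
  have hF0 : ∀ v, F' 0 v = x v ^ (n + 1) - n * (x v ^ (n - 1) * y v ^ 2) := fun v => by
    simp only [F', Real.cos_zero, Real.sin_zero]; ring
  simp only [hF0] at h0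
  rw [integral_sub (integrable_of_continuous (by fun_prop))
    (integrable_of_continuous (by fun_prop)), integral_const_mul] at h0
  linarith

/-- A function of the trace weights the three imaginary quaternion components of `v` equally, as
conjugation by suitable elements permutes them up to signs. -/
theorem integral_re_pow_mul_im_sq (n : ℕ) :
    3 * ∫ v : SU2, ((v : Matrix (Fin 2) (Fin 2) ℂ) 0 0).re ^ n
        * ((v : Matrix (Fin 2) (Fin 2) ℂ) 0 0).im ^ 2 ∂haar
      = (∫ v : SU2, ((v : Matrix (Fin 2) (Fin 2) ℂ) 0 0).re ^ n ∂haar)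
        - ∫ v : SU2, ((v : Matrix (Fin 2) (Fin 2) ℂ) 0 0).re ^ (n + 2) ∂haar := by
  have hc : Continuous fun v : SU2 => ((v : Matrix (Fin 2) (Fin 2) ℂ) 0 0).re :=
    Complex.continuous_re.comp (continuous_entry 0 0)
  have hd : Continuous fun v : SU2 => ((v : Matrix (Fin 2) (Fin 2) ℂ) 0 0).im :=
    Complex.continuous_im.comp (continuous_entry 0 0)
  have hc' : Continuous fun v : SU2 => ((v : Matrix (Fin 2) (Fin 2) ℂ) 0 1).re :=
    Complex.continuous_re.comp (continuous_entry 0 1)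
  have hd' : Continuous fun v : SU2 => ((v : Matrix (Fin 2) (Fin 2) ℂ) 0 1).im :=
    Complex.continuous_im.comp (continuous_entry 0 1)
  have hre : ∀ z v : SU2, (((z * v * z⁻¹ : SU2) : Matrix (Fin 2) (Fin 2) ℂ) 0 0).re
      = ((v : Matrix (Fin 2) (Fin 2) ℂ) 0 0).re := fun z v => by
    rw [← halfTrace_eq_re, ← halfTrace_eq_re, halfTrace_conj]
  -- Conjugation by `g_{π/2}` exchanges the real and the imaginary part of `v₀₁` up to a sign.
  have h1 : ∫ v : SU2, ((v : Matrix (Fin 2) (Fin 2) ℂ) 0 0).re ^ n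
        * ((v : Matrix (Fin 2) (Fin 2) ℂ) 0 1).im ^ 2 ∂haar
      = ∫ v : SU2, ((v : Matrix (Fin 2) (Fin 2) ℂ) 0 0).re ^ n
        * ((v : Matrix (Fin 2) (Fin 2) ℂ) 0 1).re ^ 2 ∂haar := by
    rw [← integral_mul_mul (g (Real.pi / 2)) (g (Real.pi / 2))⁻¹ fun v : SU2 =>
      ((v : Matrix (Fin 2) (Fin 2) ℂ) 0 0).re ^ n * ((v : Matrix (Fin 2) (Fin 2) ℂ) 0 1).im ^ 2]
    refine integral_congr_ae (Filter.Eventually.of_forall fun v => ?_)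
    have h : ((g (Real.pi / 2) * v * (g (Real.pi / 2))⁻¹ : SU2) : Matrix (Fin 2) (Fin 2) ℂ) 0 1
        = Complex.I * (v : Matrix (Fin 2) (Fin 2) ℂ) 0 1 := by
      have hI : Complex.exp (Complex.I * (Real.pi / 2 : ℝ)) = Complex.I := by
        rw [mul_comm]; push_cast; exact Complex.exp_pi_div_two_mul_I
      rw [g_mul_mul_inv_g_entry, hI]
    simp only [hre, h]
    simp
  -- Conjugation by the rotation matrix of angle `π/4` carries `Im v₀₁` to `Im v₀₀`.
  have h2 : ∫ v : SU2, ((v : Matrix (Fin 2) (Fin 2) ℂ) 0 0).re ^ n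
        * ((v : Matrix (Fin 2) (Fin 2) ℂ) 0 0).im ^ 2 ∂haar
      = ∫ v : SU2, ((v : Matrix (Fin 2) (Fin 2) ℂ) 0 0).re ^ n
        * ((v : Matrix (Fin 2) (Fin 2) ℂ) 0 1).im ^ 2 ∂haar := by
    set q : ℂ := (((Real.sqrt 2)⁻¹ : ℝ) : ℂ) with hq
    have hq2 : Complex.normSq q + Complex.normSq q = 1 := by
      rw [hq, Complex.normSq_ofReal, ← mul_inv, Real.mul_self_sqrt (by norm_num)]; norm_num
    rw [← integral_mul_mul (ofRow q q hq2) (ofRow q q hq2)⁻¹ fun v : SU2 =>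
      ((v : Matrix (Fin 2) (Fin 2) ℂ) 0 0).re ^ n * ((v : Matrix (Fin 2) (Fin 2) ℂ) 0 0).im ^ 2]
    refine integral_congr_ae (Filter.Eventually.of_forall fun v => ?_)
    have h : (((ofRow q q hq2 * v * (ofRow q q hq2)⁻¹ : SU2) :
        Matrix (Fin 2) (Fin 2) ℂ) 0 0).im = ((v : Matrix (Fin 2) (Fin 2) ℂ) 0 1).im := by
      simp only [Submonoid.coe_mul, Matrix.mul_apply, Fin.sum_univ_two, coe_inv, ofRow,
        Matrix.star_apply, entry_one_one, entry_one_zero]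
      simp [hq]
      ring_nf
      rw [Real.sq_sqrt (by norm_num)]
      ring
    simp only [hre, h]
  have h3 : ∀ v : SU2, ((v : Matrix (Fin 2) (Fin 2) ℂ) 0 0).re ^ n
      - ((v : Matrix (Fin 2) (Fin 2) ℂ) 0 0).re ^ (n + 2)
      = ((v : Matrix (Fin 2) (Fin 2) ℂ) 0 0).re ^ n * ((v : Matrix (Fin 2) (Fin 2) ℂ) 0 0).im ^ 2
        + (((v : Matrix (Fin 2) (Fin 2) ℂ) 0 0).re ^ n
            * ((v : Matrix (Fin 2) (Fin 2) ℂ) 0 1).im ^ 2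
          + ((v : Matrix (Fin 2) (Fin 2) ℂ) 0 0).re ^ n
            * ((v : Matrix (Fin 2) (Fin 2) ℂ) 0 1).re ^ 2) := fun v => by
    have := normSq_add_normSq v
    simp only [Complex.normSq_apply] at this
    linear_combination (-((v : Matrix (Fin 2) (Fin 2) ℂ) 0 0).re ^ n) * this
  rw [← integral_sub (integrable_of_continuous (by fun_prop))
    (integrable_of_continuous (by fun_prop)), integral_congr_ae (Filter.Eventually.of_forall h3),
    integral_add (integrable_of_continuous (by fun_prop)) (integrable_of_continuous (by fun_prop)),
    integral_add (integrable_of_continuous (by fun_prop)) (integrable_of_continuous (by fun_prop)),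
    ← h1, ← h2]
  ring

/-- The law of the class angle under Haar measure: the density `π⁻¹ sin² (θ / 2)` on `(0, 2π)`. -/
noncomputable def angleMeasure : Measure ℝ :=
  (volume.restrict (Ioo 0 (2 * Real.pi))).withDensity
    fun θ => ENNReal.ofReal (Real.pi⁻¹ * Real.sin (θ / 2) ^ 2)

theorem measurable_angleDensity :
    Measurable fun θ : ℝ => ENNReal.ofReal (Real.pi⁻¹ * Real.sin (θ / 2) ^ 2) := by fun_prop

theorem integral_angleMeasure {E : Type*} [NormedAddCommGroup E] [NormedSpace ℝ E] (f : ℝ → E) :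
    ∫ θ, f θ ∂angleMeasure
      = ∫ θ in (0 : ℝ)..(2 * Real.pi), (Real.pi⁻¹ * Real.sin (θ / 2) ^ 2) • f θ := by
  rw [angleMeasure, integral_withDensity_eq_integral_toReal_smul measurable_angleDensity
    (Filter.Eventually.of_forall fun _ => ENNReal.ofReal_lt_top),
    intervalIntegral.integral_of_le Real.two_pi_pos.le, integral_Ioc_eq_integral_Ioo]
  refine integral_congr_ae (Filter.Eventually.of_forall fun θ => ?_)
  simp only
  rw [ENNReal.toReal_ofReal (by positivity)]

/-- The density of `angleMeasure` vanishes nowhere on `(0, 2π)`. -/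
theorem ae_angleMeasure_iff {p : ℝ → Prop} :
    (∀ᵐ θ ∂angleMeasure, p θ) ↔ ∀ᵐ θ, θ ∈ Ioo 0 (2 * Real.pi) → p θ := by
  rw [angleMeasure, ae_withDensity_iff measurable_angleDensity, ae_restrict_iff' measurableSet_Ioo]
  refine Filter.eventually_congr (Filter.Eventually.of_forall fun θ => ?_)
  refine forall_congr' fun hθ => ?_
  have : 0 < Real.sin (θ / 2) :=
    Real.sin_pos_of_pos_of_lt_pi (by linarith [hθ.1]) (by linarith [hθ.2])
  have : ENNReal.ofReal (Real.pi⁻¹ * Real.sin (θ / 2) ^ 2) ≠ 0 := by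
    rw [Ne, ENNReal.ofReal_eq_zero, not_le]; positivity
  simp [this]

instance : IsProbabilityMeasure angleMeasure where
  measure_univ := by
    have h : ∫ θ in Ioo 0 (2 * Real.pi), Real.pi⁻¹ * Real.sin (θ / 2) ^ 2 = 1 := by
      rw [← integral_Ioc_eq_integral_Ioo, ← intervalIntegral.integral_of_le Real.two_pi_pos.le,
        intervalIntegral.integral_const_mul,
        intervalIntegral.integral_comp_div (fun x => Real.sin x ^ 2) two_ne_zero, integral_sin_sq]
      have := Real.pi_ne_zero
      simp
      field_simp
    have hint : IntegrableOn (fun θ => Real.pi⁻¹ * Real.sin (θ / 2) ^ 2) (Ioo 0 (2 * Real.pi)) :=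
      (Continuous.integrableOn_Icc (by fun_prop)).mono_set Ioo_subset_Icc_self
    rw [angleMeasure, withDensity_apply _ MeasurableSet.univ, Measure.restrict_univ,
      ← ofReal_integral_eq_lintegral_ofReal hint
        (Filter.Eventually.of_forall fun θ => by positivity), h, ENNReal.ofReal_one]

theorem integrable_comp_cos_angleMeasure {φ : ℝ → ℝ} (hφ : Continuous φ) :
    Integrable (fun θ => φ (Real.cos (θ / 2))) angleMeasure := by
  obtain ⟨C, hC⟩ := (isCompact_Icc (a := (-1 : ℝ)) (b := 1)).exists_bound_of_continuousOn
    hφ.continuousOn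
  exact Integrable.of_bound (by fun_prop) C
    (Filter.Eventually.of_forall fun θ => hC _ (Real.cos_mem_Icc _))

theorem integrable_comp_halfTrace {φ : ℝ → ℝ} (hφ : Continuous φ) :
    Integrable (fun v => φ (halfTrace v)) haar :=
  integrable_of_continuous (hφ.comp continuous_halfTrace)

/-- Integration by parts, with the antiderivative `cos ^ n * sin ^ 3` of half of the angle. -/
theorem integral_cos_pow_succ_angleMeasure (n : ℕ) :
    3 * ∫ θ, Real.cos (θ / 2) ^ (n + 1) ∂angleMeasure
      = n * ((∫ θ, Real.cos (θ / 2) ^ (n - 1) ∂angleMeasure)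
        - ∫ θ, Real.cos (θ / 2) ^ (n + 1) ∂angleMeasure) := by
  have hi : ∀ m : ℕ, Integrable (fun θ => Real.cos (θ / 2) ^ m) angleMeasure := fun m =>
    integrable_comp_cos_angleMeasure (continuous_pow m)
  have hi' : Integrable (fun θ => n * (Real.cos (θ / 2) ^ (n - 1) - Real.cos (θ / 2) ^ (n + 1)))
      angleMeasure := ((hi _).sub (hi _)).const_mul _
  rw [← integral_sub (hi _) (hi _), ← integral_const_mul, ← integral_const_mul, ← sub_eq_zero,
    ← integral_sub ((hi _).const_mul _) hi', integral_angleMeasure]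
  have hder : ∀ θ : ℝ, HasDerivAt
      (fun θ => 2 * Real.pi⁻¹ * (Real.cos (θ / 2) ^ n * Real.sin (θ / 2) ^ 3))
      ((Real.pi⁻¹ * Real.sin (θ / 2) ^ 2) • (3 * Real.cos (θ / 2) ^ (n + 1)
        - n * (Real.cos (θ / 2) ^ (n - 1) - Real.cos (θ / 2) ^ (n + 1)))) θ := fun θ => by
    have h0 : HasDerivAt (fun θ : ℝ => θ / 2) (1 / 2) θ := (hasDerivAt_id θ).div_const 2
    have h := ((h0.cos.pow n).mul (h0.sin.pow 3)).const_mul (2 * Real.pi⁻¹)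
    refine h.congr_deriv ?_
    have hs : Real.sin (θ / 2) ^ 2 = 1 - Real.cos (θ / 2) ^ 2 := Real.sin_sq _
    rcases n with _ | n
    · simp
      ring
    · simp only [Nat.add_sub_cancel, smul_eq_mul, Pi.pow_apply]
      push_cast
      linear_combination (-Real.pi⁻¹ * (n + 1) * Real.cos (θ / 2) ^ n * Real.sin (θ / 2) ^ 2) * hs
  rw [intervalIntegral.integral_eq_sub_of_hasDerivAt (fun θ _ => hder θ)
    (Continuous.intervalIntegrable (by fun_prop) _ _)]
  simp

/-- The moments of half of the trace obey the same recursion under both measures. -/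
theorem integral_halfTrace_pow (n : ℕ) :
    ∫ v, halfTrace v ^ n ∂haar = ∫ θ, Real.cos (θ / 2) ^ n ∂angleMeasure := by
  induction n using Nat.strong_induction_on with
  | _ n ih =>
    rcases n with _ | n
    · simp
    · have h1 := integral_re_pow_succ n
      have h2 := integral_cos_pow_succ_angleMeasure n
      rcases n with _ | n
      · simp only [← halfTrace_eq_re] at h1
        simp only [Nat.cast_zero, zero_mul] at h1 h2
        linarith
      · have h3 := integral_re_pow_mul_im_sq n
        have h4 := ih n (by omega)
        simp only [Nat.add_sub_cancel] at h1 h2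
        simp only [← halfTrace_eq_re] at h1 h3
        rw [h4] at h3
        have hn : (0 : ℝ) < ((n + 1 : ℕ) : ℝ) + 3 := by positivity
        refine mul_left_cancel₀ hn.ne' ?_
        linear_combination 3 * h1 - h2 + ((n + 1 : ℕ) : ℝ) * h3

theorem integral_polynomial_halfTrace (p : Polynomial ℝ) :
    ∫ v, p.eval (halfTrace v) ∂haar = ∫ θ, p.eval (Real.cos (θ / 2)) ∂angleMeasure := by
  induction p using Polynomial.induction_on' with
  | add p q hp hq =>
    simp only [Polynomial.eval_add]
    rw [integral_add (integrable_comp_halfTrace p.continuous)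
        (integrable_comp_halfTrace q.continuous),
      integral_add (integrable_comp_cos_angleMeasure p.continuous)
        (integrable_comp_cos_angleMeasure q.continuous), hp, hq]
  | monomial n a =>
    simp only [Polynomial.eval_monomial]
    rw [integral_const_mul, integral_const_mul, integral_halfTrace_pow]

/-- Half of the trace has the same law under Haar measure as `cos (θ / 2)` under `angleMeasure`, by
equality of the moments and polynomial approximation on `[-1, 1]`. -/
theorem integral_comp_halfTrace {φ : ℝ → ℝ} (hφ : Continuous φ) :
    ∫ v, φ (halfTrace v) ∂haar = ∫ θ, φ (Real.cos (θ / 2)) ∂angleMeasure := by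
  refine eq_of_forall_dist_le fun ε hε => ?_
  obtain ⟨p, hp⟩ := exists_polynomial_near_of_continuousOn (-1) 1 φ hφ.continuousOn
    (ε / 2) (by positivity)
  have h1 : dist (∫ v, φ (halfTrace v) ∂haar) (∫ v, p.eval (halfTrace v) ∂haar) ≤ ε / 2 := by
    rw [dist_comm, dist_eq_norm, ← integral_sub (integrable_comp_halfTrace p.continuous)
      (integrable_comp_halfTrace hφ)]
    refine (norm_integral_le_of_norm_le_const (C := ε / 2) (Filter.Eventually.of_forall fun v =>
      (hp _ (halfTrace_mem_Icc v)).le)).trans ?_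
    simp
  have h2 : dist (∫ θ, p.eval (Real.cos (θ / 2)) ∂angleMeasure)
      (∫ θ, φ (Real.cos (θ / 2)) ∂angleMeasure) ≤ ε / 2 := by
    rw [dist_eq_norm, ← integral_sub (integrable_comp_cos_angleMeasure p.continuous)
      (integrable_comp_cos_angleMeasure hφ)]
    refine (norm_integral_le_of_norm_le_const (C := ε / 2) (Filter.Eventually.of_forall fun θ =>
      (hp _ (Real.cos_mem_Icc _)).le)).trans ?_
    simp
  rw [← integral_polynomial_halfTrace] at h2
  linarith [dist_triangle (∫ v, φ (halfTrace v) ∂haar) (∫ v, p.eval (halfTrace v) ∂haar)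
    (∫ θ, φ (Real.cos (θ / 2)) ∂angleMeasure)]

theorem measurable_conj_g : Measurable fun p : SU2 × ℝ => p.1 * g p.2 * p.1⁻¹ :=
  Continuous.measurable (by have := continuous_g; fun_prop)

/-- The Weyl integration formula for `SU(2)`. The mean of a continuous function over a conjugacy
class is a continuous function of the trace, whose law under Haar measure is known. -/
theorem measurePreserving_conj_g :
    MeasurePreserving (fun p : SU2 × ℝ => p.1 * g p.2 * p.1⁻¹) (haar.prod angleMeasure) haar := by
  refine ⟨measurable_conj_g, ?_⟩
  have : IsProbabilityMeasure
      ((haar.prod angleMeasure).map fun p : SU2 × ℝ => p.1 * g p.2 * p.1⁻¹) :=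
    Measure.isProbabilityMeasure_map measurable_conj_g.aemeasurable
  refine ext_of_forall_integral_eq_of_IsFiniteMeasure fun f => ?_
  have hf := f.continuous
  obtain ⟨C, hC⟩ : ∃ C, ∀ v, ‖f v‖ ≤ C := ⟨‖f‖, f.norm_coe_le_norm⟩
  let Φ : SU2 → ℝ := fun v => ∫ z, f (z * v * z⁻¹) ∂haar
  have hΦ : Continuous Φ :=
    continuous_of_dominated
      (fun v => Continuous.aestronglyMeasurable (by fun_prop))
      (fun v => Filter.Eventually.of_forall fun z => hC _) (integrable_const C)
      (Filter.Eventually.of_forall fun z => by fun_prop)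
  have hΦconj : ∀ x v, Φ (x * v * x⁻¹) = Φ v := fun x v => by
    simp only [Φ]
    rw [← integral_mul_right_eq_self (fun z => f (z * v * z⁻¹)) x]
    simp only [mul_inv_rev, mul_assoc]
  have hΦg : ∀ v, Φ v = Φ (g (2 * Real.arccos (halfTrace v))) := fun v => by
    obtain ⟨z, hz⟩ := exists_conj_g v
    conv_lhs => rw [hz, hΦconj]
  have hφ : Continuous fun x => Φ (g (2 * Real.arccos x)) :=
    hΦ.comp (continuous_g.comp (continuous_const.mul Real.continuous_arccos))
  have hF : ∫ v, Φ v ∂haar = ∫ v, f v ∂haar := by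
    have hswap := integral_integral_swap (μ := haar) (ν := haar)
      (f := fun v z : SU2 => f (z * v * z⁻¹)) (Integrable.of_bound
        (Continuous.aestronglyMeasurable (by fun_prop)) C
        (Filter.Eventually.of_forall fun p => hC _))
    rw [hswap]
    simp only [integral_mul_mul]
    simp
  have hint : Integrable (fun p : SU2 × ℝ => f (p.1 * g p.2 * p.1⁻¹)) (haar.prod angleMeasure) :=
    Integrable.of_bound (hf.measurable.comp measurable_conj_g).aestronglyMeasurable C
      (Filter.Eventually.of_forall fun p => hC _)
  rw [integral_map measurable_conj_g.aemeasurable hf.aestronglyMeasurable,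
    integral_prod_symm _ hint, ← hF]
  calc ∫ θ, Φ (g θ) ∂angleMeasure
      = ∫ θ, Φ (g (2 * Real.arccos (Real.cos (θ / 2)))) ∂angleMeasure := by
        refine integral_congr_ae (Filter.Eventually.of_forall fun θ => ?_)
        simp only
        rw [hΦg, halfTrace_g]
    _ = ∫ v, Φ v ∂haar := by
        rw [← integral_comp_halfTrace hφ]
        exact integral_congr_ae (Filter.Eventually.of_forall fun v => (hΦg v).symm)

/-- A Haar null set meets almost every conjugacy class in a null set. -/
theorem ae_ae_conj_g {p : SU2 → Prop} (hp : ∀ᵐ v ∂haar, p v) :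
    ∀ᵐ θ, θ ∈ Ioo 0 (2 * Real.pi) → ∀ᵐ z ∂haar, p (z * g θ * z⁻¹) := by
  rw [← ae_angleMeasure_iff]
  have h := (Measure.measurePreserving_swap.quasiMeasurePreserving.ae
    (measurePreserving_conj_g.quasiMeasurePreserving.ae hp) :
    ∀ᵐ q : ℝ × SU2 ∂(angleMeasure.prod haar), p (q.2 * g q.1 * q.2⁻¹))
  exact Measure.ae_ae_of_ae_prod h

/-- A property that holds throughout almost every conjugacy class holds almost everywhere. -/
theorem ae_of_ae_g {p : SU2 → Prop} (hm : MeasurableSet {v | p v})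
    (hp : ∀ᵐ θ, θ ∈ Ioo 0 (2 * Real.pi) → ∀ z, p (z * g θ * z⁻¹)) : ∀ᵐ v ∂haar, p v := by
  rw [← measurePreserving_conj_g.map_eq, ae_map_iff measurable_conj_g.aemeasurable hm]
  have h := ae_angleMeasure_iff.mpr hp
  filter_upwards [Measure.quasiMeasurePreserving_snd.ae h] with q hq using hq q.1

end SU2

/-! ### Symbols of the Wilson loops -/

theorem isSingular_iff_sin_eq_zero {μ : ℝ} : IsSingular μ ↔ Real.sin (μ / 2) = 0 := by
  rw [Real.sin_eq_zero_iff, IsSingular]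
  refine exists_congr fun m => ⟨fun h => ?_, fun h => ?_⟩ <;> linarith

namespace SU2

/-- The element `2 J₀ = diag (i, -i)` of the Lie algebra of the diagonal torus. -/
def diagI : Matrix (Fin 2) (Fin 2) ℂ := !![Complex.I, 0; 0, -Complex.I]

theorem coe_g (θ : ℝ) : (g θ : Matrix (Fin 2) (Fin 2) ℂ)
    = (Real.cos (θ / 2) : ℂ) • (1 : Matrix (Fin 2) (Fin 2) ℂ) + (Real.sin (θ / 2) : ℂ) • diagI := by
  have h1 : Complex.exp (Complex.I * θ / 2)
      = (Real.cos (θ / 2) : ℂ) + (Real.sin (θ / 2) : ℂ) * Complex.I := by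
    rw [Complex.ofReal_cos, Complex.ofReal_sin, ← Complex.exp_mul_I]; congr 1; push_cast; ring
  have h2 : Complex.exp (-(Complex.I * θ / 2))
      = (Real.cos (θ / 2) : ℂ) - (Real.sin (θ / 2) : ℂ) * Complex.I := by
    have := Complex.exp_mul_I (-(θ / 2 : ℝ) : ℂ)
    rw [Complex.cos_neg, Complex.sin_neg] at this
    rw [Complex.ofReal_cos, Complex.ofReal_sin, sub_eq_add_neg, ← neg_mul, ← this]
    congr 1; push_cast; ring
  ext i j
  fin_cases i <;> fin_cases j <;> simp [g, diagI, h1, h2]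
  ring

theorem coe_conj_g (z : SU2) (θ : ℝ) : ((z * g θ * z⁻¹ : SU2) : Matrix (Fin 2) (Fin 2) ℂ)
    = (Real.cos (θ / 2) : ℂ) • (1 : Matrix (Fin 2) (Fin 2) ℂ)
      + (Real.sin (θ / 2) : ℂ) • ((z : Matrix (Fin 2) (Fin 2) ℂ) * diagI * star z.1) := by
  have h : (z : Matrix (Fin 2) (Fin 2) ℂ) * star z.1 = 1 :=
    Matrix.mem_unitaryGroup_iff.mp (Matrix.mem_specialUnitaryGroup_iff.mp z.2).1
  rw [Submonoid.coe_mul, Submonoid.coe_mul, coe_inv, coe_g, mul_add, add_mul]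
  simp [h]

theorem conj_g_of_isSingular {μ : ℝ} (hμ : IsSingular μ) (z : SU2) : z * g μ * z⁻¹ = g μ := by
  apply Subtype.ext
  rw [coe_conj_g, coe_g, isSingular_iff_sin_eq_zero.mp hμ]
  simp

open Classical in
/-- The element of angle `μ` of the one-parameter group through `v`: for `v = z g_θ z⁻¹` with
`0 < θ < 2π` it is `z g_μ z⁻¹`. For `v = ± 1` there is no distinguished one-parameter group; the
value there is immaterial unless `g_μ` is central. -/
noncomputable def rotate (μ : ℝ) (v : SU2) : SU2 :=
  if h : (Real.cos (μ / 2) : ℂ) • (1 : Matrix (Fin 2) (Fin 2) ℂ)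
      + ((Real.sin (μ / 2) / Real.sqrt (1 - halfTrace v ^ 2) : ℝ) : ℂ)
        • ((v : Matrix (Fin 2) (Fin 2) ℂ) - (halfTrace v : ℂ) • (1 : Matrix (Fin 2) (Fin 2) ℂ))
      ∈ Matrix.specialUnitaryGroup (Fin 2) ℂ
  then ⟨_, h⟩ else 1

theorem sqrt_one_sub_cos_sq {θ : ℝ} (hθ : θ ∈ Ioo 0 (2 * Real.pi)) :
    Real.sqrt (1 - Real.cos (θ / 2) ^ 2) = Real.sin (θ / 2) := by
  rw [← Real.sin_sq, Real.sqrt_sq]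
  exact (Real.sin_pos_of_pos_of_lt_pi (by linarith [hθ.1]) (by linarith [hθ.2])).le

theorem rotate_eq_of_coe_eq {μ : ℝ} {v w : SU2}
    (h : (Real.cos (μ / 2) : ℂ) • (1 : Matrix (Fin 2) (Fin 2) ℂ)
      + ((Real.sin (μ / 2) / Real.sqrt (1 - halfTrace v ^ 2) : ℝ) : ℂ)
        • ((v : Matrix (Fin 2) (Fin 2) ℂ) - (halfTrace v : ℂ) • (1 : Matrix (Fin 2) (Fin 2) ℂ))
      = w) : rotate μ v = w := by
  rw [rotate, dif_pos (h ▸ w.2)]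
  exact Subtype.ext h

theorem rotate_conj_g (μ : ℝ) (z : SU2) {θ : ℝ} (hθ : θ ∈ Ioo 0 (2 * Real.pi)) :
    rotate μ (z * g θ * z⁻¹) = z * g μ * z⁻¹ := by
  have hs : 0 < Real.sin (θ / 2) :=
    Real.sin_pos_of_pos_of_lt_pi (by linarith [hθ.1]) (by linarith [hθ.2])
  apply rotate_eq_of_coe_eq
  rw [halfTrace_conj, halfTrace_g, sqrt_one_sub_cos_sq hθ, coe_conj_g, coe_conj_g,
    add_sub_cancel_left, smul_smul, ← Complex.ofReal_mul, div_mul_cancel₀ _ hs.ne']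

theorem rotate_of_isSingular {μ : ℝ} (hμ : IsSingular μ) (v : SU2) : rotate μ v = g μ := by
  apply rotate_eq_of_coe_eq
  rw [coe_g, isSingular_iff_sin_eq_zero.mp hμ]
  simp

theorem exists_conj_g_of_sq_ne_one {v : SU2} (hv : halfTrace v ^ 2 ≠ 1) :
    ∃ z : SU2, ∃ θ ∈ Ioo 0 (2 * Real.pi), v = z * g θ * z⁻¹ := by
  obtain ⟨z, hz⟩ := exists_conj_g v
  have h1 : halfTrace v ≠ 1 := fun h => hv (by rw [h]; norm_num)
  have h2 : halfTrace v ≠ -1 := fun h => hv (by rw [h]; norm_num)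
  have h3 := halfTrace_mem_Icc v
  refine ⟨z, _, ⟨?_, ?_⟩, hz⟩
  · have := Real.arccos_pos.mpr (lt_of_le_of_ne h3.2 h1)
    linarith
  · have : Real.arccos (halfTrace v) < Real.pi :=
      lt_of_le_of_ne (Real.arccos_le_pi _) fun h =>
        absurd (Real.arccos_eq_pi.mp h) (not_le.mpr (lt_of_le_of_ne h3.1 h2.symm))
    linarith

theorem measurable_rotate (μ : ℝ) : Measurable (rotate μ) := by
  classical
  have hcl : IsClosed {v : SU2 | halfTrace v ^ 2 = 1} :=
    isClosed_eq (continuous_halfTrace.pow 2) continuous_const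
  have h1 : ContinuousOn (rotate μ) {v : SU2 | halfTrace v ^ 2 = 1}ᶜ := by
    rw [Topology.IsInducing.subtypeVal.continuousOn_iff]
    have : ContinuousOn (fun v : SU2 => (Real.cos (μ / 2) : ℂ) • (1 : Matrix (Fin 2) (Fin 2) ℂ)
      + ((Real.sin (μ / 2) / Real.sqrt (1 - halfTrace v ^ 2) : ℝ) : ℂ)
        • ((v : Matrix (Fin 2) (Fin 2) ℂ) - (halfTrace v : ℂ) • (1 : Matrix (Fin 2) (Fin 2) ℂ)))
        {v : SU2 | halfTrace v ^ 2 = 1}ᶜ := by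
      have hc := continuous_halfTrace
      refine ContinuousOn.fun_add continuousOn_const (ContinuousOn.fun_smul ?_ ?_)
      · refine Complex.continuous_ofReal.comp_continuousOn
          (ContinuousOn.div continuousOn_const (by fun_prop) fun v hv => ?_)
        refine (Real.sqrt_pos.mpr ?_).ne'
        have := (sq_le_one_iff_abs_le_one _).mpr (abs_halfTrace_le_one v)
        exact sub_pos.mpr (lt_of_le_of_ne this hv)
      · have : Continuous fun v : SU2 => (v : Matrix (Fin 2) (Fin 2) ℂ) := continuous_subtype_val
        fun_prop
    refine this.congr fun v hv => ?_
    obtain ⟨z, θ, hθ, rfl⟩ := exists_conj_g_of_sq_ne_one hv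
    have hs : 0 < Real.sin (θ / 2) :=
      Real.sin_pos_of_pos_of_lt_pi (by linarith [hθ.1]) (by linarith [hθ.2])
    simp only [Function.comp]
    rw [rotate_conj_g μ z hθ, halfTrace_conj, halfTrace_g, sqrt_one_sub_cos_sq hθ, coe_conj_g,
      coe_conj_g, add_sub_cancel_left, smul_smul, ← Complex.ofReal_mul, div_mul_cancel₀ _ hs.ne']
  -- On this set the quotient in `rotate` is a division by `0`, so that `rotate μ` is constant.
  have h2 : ContinuousOn (rotate μ) {v : SU2 | halfTrace v ^ 2 = 1} := by
    refine (continuousOn_const (c := rotate μ 1)).congr fun v hv => ?_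
    have h1 : halfTrace (1 : SU2) ^ 2 = 1 := by simp [halfTrace]
    have hv' : halfTrace v ^ 2 = 1 := hv
    simp only [rotate, hv', h1, sub_self, Real.sqrt_zero, div_zero, Complex.ofReal_zero, zero_smul]
  have := ContinuousOn.measurable_piecewise h2 h1 hcl.measurableSet
  rwa [piecewise_same] at this

theorem continuous_character (n : ℕ) : Continuous (character n) :=
  (Polynomial.Chebyshev.U ℝ n).continuous.comp continuous_halfTrace

theorem character_conj (n : ℕ) (z v : SU2) : character n (z * v * z⁻¹) = character n v := by
  have := halfTrace_conj z v
  unfold halfTrace at this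
  rw [character, character, this]

theorem ae_character_ne_zero (n : ℕ) : ∀ᵐ v ∂haar, character n v ≠ 0 := by
  refine ae_of_ae_g ((continuous_character n).measurable (measurableSet_singleton 0).compl) ?_
  have hcount : (range fun m : ℤ => 2 * m * Real.pi / (n + 1)).Countable := countable_range _
  filter_upwards [hcount.ae_notMem volume] with θ hθ _ z h
  rw [character_conj] at h
  have h2 := character_g n θ
  rw [h, zero_mul, eq_comm, Real.sin_eq_zero_iff] at h2
  obtain ⟨m, hm⟩ := h2
  refine hθ ⟨m, ?_⟩
  have : (n : ℝ) + 1 ≠ 0 := by positivity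
  field_simp
  linarith

/-- The density of the Wilson loops. For `g_μ ≠ ± 1` it is the Weyl density `π⁻¹ sin² (θ / 2)` of
the class of `v`, and for `g_μ = ± 1` it cancels the character of spin `|k| / 2`, whose zeros form a
null set, where the inverse is `0`. -/
noncomputable def loopDensity (k : ℤ) (u v : SU2) : ℝ :=
  if halfTrace u ^ 2 = 1 then (character k.natAbs v)⁻¹ else Real.pi⁻¹ * (1 - halfTrace v ^ 2)

theorem measurable_loopDensity (k : ℤ) : Measurable fun p : SU2 × SU2 => loopDensity k p.1 p.2 := by
  have h := continuous_halfTrace.measurable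
  have h' := (continuous_character k.natAbs).measurable
  unfold loopDensity
  refine Measurable.ite ?_ ?_ ?_
  · exact (((h.comp measurable_fst).pow_const 2) (measurableSet_singleton 1))
  · exact (h'.comp measurable_snd).inv
  · exact (((h.comp measurable_snd).pow_const 2).const_sub 1).const_mul _

theorem loopDensity_conj (k : ℤ) (x u v : SU2) :
    loopDensity k (x⁻¹ * u * x) (x⁻¹ * v * x) = loopDensity k u v := by
  have h := halfTrace_conj x⁻¹
  have h' := character_conj k.natAbs x⁻¹
  simp only [inv_inv] at h h'
  simp only [loopDensity, h, h']

theorem halfTrace_g_sq_eq_one_iff {μ : ℝ} : halfTrace (g μ) ^ 2 = 1 ↔ IsSingular μ := by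
  rw [isSingular_iff_sin_eq_zero, halfTrace_g, ← sq_eq_zero_iff (a := Real.sin (μ / 2)),
    Real.sin_sq, sub_eq_zero, eq_comm]

theorem loopDensity_of_not_isSingular (k : ℤ) {μ : ℝ} (hμ : ¬ IsSingular μ) (v : SU2) :
    loopDensity k (g μ) v = Real.pi⁻¹ * (1 - halfTrace v ^ 2) :=
  if_neg (mt halfTrace_g_sq_eq_one_iff.mp hμ)

theorem loopDensity_of_isSingular (k : ℤ) {μ : ℝ} (hμ : IsSingular μ) (v : SU2) :
    loopDensity k (g μ) v = (character k.natAbs v)⁻¹ :=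
  if_pos (halfTrace_g_sq_eq_one_iff.mpr hμ)

end SU2

open SU2

open Classical in
/-- The phase by which the Wilson loop `W_{μ, k/2}` acts at class angle `θ`. -/
noncomputable def loopPhase (μ : ℝ) (k : ℤ) (θ : ℝ) : ℂ :=
  if IsSingular μ then 1 else Complex.exp (Complex.I * ((k : ℝ) / 2 : ℝ) * θ)

theorem continuous_loopPhase (μ : ℝ) (k : ℤ) : Continuous (loopPhase μ k) := by
  unfold loopPhase
  split_ifs <;> fun_prop

theorem norm_loopPhase (μ : ℝ) (k : ℤ) (θ : ℝ) : ‖loopPhase μ k θ‖ = 1 := by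
  unfold loopPhase
  split_ifs
  · simp
  · rw [mul_assoc, ← Complex.ofReal_mul, Complex.norm_exp_I_mul_ofReal]

/-- The coefficient of the Wilson loop, the phase of the class angle `2 arccos (tr v / 2)`. -/
noncomputable def loopCoeff (μ : ℝ) (k : ℤ) (v : SU2) : ℂ :=
  loopPhase μ k (2 * Real.arccos (halfTrace v))

theorem continuous_loopCoeff (μ : ℝ) (k : ℤ) : Continuous (loopCoeff μ k) :=
  (continuous_loopPhase μ k).comp
    (continuous_const.mul (Real.continuous_arccos.comp continuous_halfTrace))

theorem loopCoeff_conj_g (μ : ℝ) (k : ℤ) (z : SU2) {θ : ℝ} (hθ : θ ∈ Ioo 0 (2 * Real.pi)) :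
    loopCoeff μ k (z * g θ * z⁻¹) = loopPhase μ k θ := by
  rw [loopCoeff, halfTrace_conj, halfTrace_g,
    Real.arccos_cos (by linarith [hθ.1]) (by linarith [hθ.2]), mul_div_cancel₀ _ two_ne_zero]

/-- The Wilson loop is `∫ dv c(v) X(v, κ(v))` with `c = loopCoeff` and `κ = rotate`. -/
theorem hasSymbol_wilsonLoop (μ : ℝ) (k : ℤ) :
    HasSymbol (wilsonLoop (loopDensity k) μ k) (loopCoeff μ k) (rotate μ) := by
  refine ⟨integrable_of_continuous (continuous_loopCoeff μ k), measurable_rotate μ, fun F hF => ?_⟩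
  by_cases hμ : IsSingular μ
  · rw [wilsonLoop, if_pos hμ]
    have hinner : ∀ z : SU2, (∫ n, ((loopDensity k (g μ) n * character k.natAbs n : ℝ) : ℂ)
        * F (z * n * z⁻¹) (z * g μ * z⁻¹) ∂haar) = ∫ n, F n (g μ) ∂haar := fun z => by
      rw [← integral_mul_mul z z⁻¹ fun n => F n (g μ)]
      refine integral_congr_ae ?_
      filter_upwards [ae_character_ne_zero k.natAbs] with n hn
      rw [loopDensity_of_isSingular k hμ, inv_mul_cancel₀ hn, conj_g_of_isSingular hμ]
      simp
    simp only [hinner, rotate_of_isSingular hμ, loopCoeff, loopPhase, if_pos hμ]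
    simp
  · rw [wilsonLoop, if_neg hμ]
    have hmeas : Measurable fun v => loopCoeff μ k v * F v (rotate μ v) :=
      (continuous_loopCoeff μ k).measurable.mul
        (hF.measurable.comp (measurable_id.prodMk (measurable_rotate μ)))
    obtain ⟨C, hC⟩ := isCompact_univ.exists_bound_of_continuousOn hF.continuousOn
    have hint : Integrable (fun p : SU2 × ℝ => loopCoeff μ k (p.1 * g p.2 * p.1⁻¹)
        * F (p.1 * g p.2 * p.1⁻¹) (rotate μ (p.1 * g p.2 * p.1⁻¹))) (haar.prod angleMeasure) := by
      refine Integrable.of_bound (hmeas.comp measurable_conj_g).aestronglyMeasurable C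
        (Filter.Eventually.of_forall fun p => ?_)
      rw [norm_mul, loopCoeff, norm_loopPhase, one_mul]
      exact hC (_, _) (mem_univ _)
    conv_rhs => rw [← measurePreserving_conj_g.map_eq]
    rw [integral_map measurable_conj_g.aemeasurable hmeas.aestronglyMeasurable,
      integral_prod _ hint]
    refine integral_congr_ae (Filter.Eventually.of_forall fun z => ?_)
    simp only
    rw [integral_angleMeasure, intervalIntegral.integral_of_le Real.two_pi_pos.le,
      intervalIntegral.integral_of_le Real.two_pi_pos.le, integral_Ioc_eq_integral_Ioo,
      integral_Ioc_eq_integral_Ioo]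
    refine setIntegral_congr_fun measurableSet_Ioo fun θ hθ => ?_
    rw [loopCoeff_conj_g μ k z hθ, rotate_conj_g μ z hθ, loopDensity_of_not_isSingular k hμ,
      halfTrace_g, ← Real.sin_sq, loopPhase, if_neg hμ, Complex.real_smul, mul_assoc]

/-- Integrable functions that agree as functionals on continuous functions agree almost everywhere:
indicators of closed sets are limits of continuous functions. -/
theorem ae_eq_of_forall_integral_mul_continuous {c d : SU2 → ℂ} (hc : Integrable c haar)
    (hd : Integrable d haar)
    (h : ∀ f : SU2 → ℂ, Continuous f → ∫ v, c v * f v ∂haar = ∫ v, d v * f v ∂haar) :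
    c =ᵐ[haar] d := by
  rw [← sub_ae_eq_zero]
  refine ae_eq_zero_of_forall_setIntegral_isClosed_eq_zero (hc.sub hd) fun s hs => ?_
  have hcont : ∀ n, Continuous fun v : SU2 => ((hs.apprSeq n v : ℝ) : ℂ) := fun n => by
    have := (hs.apprSeq n).continuous
    fun_prop
  have hle : ∀ n (v : SU2), ‖((hs.apprSeq n v : ℝ) : ℂ)‖ ≤ 1 := fun n v => by
    rw [Complex.norm_real, NNReal.norm_eq]
    exact_mod_cast HasOuterApproxClosed.apprSeq_apply_le_one hs n v
  have hzero : ∀ n, ∫ v, (c - d) v * ((hs.apprSeq n v : ℝ) : ℂ) ∂haar = 0 := fun n => by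
    simp only [Pi.sub_apply, sub_mul]
    rw [integral_sub, h _ (hcont n), sub_self]
    · exact hc.mul_bdd (hcont n).aestronglyMeasurable (Filter.Eventually.of_forall (hle n))
    · exact hd.mul_bdd (hcont n).aestronglyMeasurable (Filter.Eventually.of_forall (hle n))
  have hlim := tendsto_integral_of_dominated_convergence (μ := haar)
    (F := fun n v => (c - d) v * ((hs.apprSeq n v : ℝ) : ℂ)) (f := s.indicator (c - d))
    (fun v => ‖(c - d) v‖)
    (fun n => (hc.sub hd).aestronglyMeasurable.mul (hcont n).aestronglyMeasurable)
    (hc.sub hd).norm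
    (fun n => Filter.Eventually.of_forall fun v => by
      rw [norm_mul]
      exact mul_le_of_le_one_right (norm_nonneg _) (hle n v))
    (Filter.Eventually.of_forall fun v => by
      have h1 := (tendsto_pi_nhds.mp (HasOuterApproxClosed.tendsto_apprSeq hs)) v
      have h2 : Filter.Tendsto (fun n => ((hs.apprSeq n v : ℝ) : ℂ)) Filter.atTop
          (nhds (((s.indicator (fun _ => (1 : NNReal)) v : NNReal) : ℝ) : ℂ)) :=
        (Complex.continuous_ofReal.comp NNReal.continuous_coe).continuousAt.tendsto.comp h1
      have h3 := h2.const_mul ((c - d) v)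
      by_cases hv : v ∈ s
      · simpa [hv] using h3
      · simpa [hv] using h3)
  simp only [hzero] at hlim
  rw [← integral_indicator hs.measurableSet]
  exact tendsto_nhds_unique hlim tendsto_const_nhds

/-- The symbol of an element of the graph algebra is determined almost everywhere, when its
coefficient vanishes nowhere. -/
theorem HasSymbol.ae_eq {L : (SU2 → SU2 → ℂ) → ℂ} {c c' : SU2 → ℂ} {κ κ' : SU2 → SU2}
    (h : HasSymbol L c κ) (h' : HasSymbol L c' κ') (hc' : ∀ v, c' v ≠ 0) :
    c =ᵐ[haar] c' ∧ κ =ᵐ[haar] κ' := by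
  have h1 : c =ᵐ[haar] c' := ae_eq_of_forall_integral_mul_continuous h.1 h'.1 fun f hf => by
    have hF : Continuous fun p : SU2 × SU2 => f p.1 := by fun_prop
    rw [← h.2.2 (fun v _ => f v) hF, ← h'.2.2 (fun v _ => f v) hF]
  have hint : ∀ (i j : Fin 2) {c : SU2 → ℂ} {κ : SU2 → SU2}, Integrable c haar → Measurable κ →
      Integrable (fun v => c v * (κ v : Matrix (Fin 2) (Fin 2) ℂ) i j) haar :=
    fun i j c κ hc hκ => hc.mul_bdd
      ((continuous_entry i j).measurable.comp hκ).aestronglyMeasurable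
      (Filter.Eventually.of_forall fun v => norm_entry_le_one (κ v) i j)
  -- The matrix entries of `u` as test functions recover `κ`.
  have h2 : ∀ i j : Fin 2, (fun v => c v * (κ v : Matrix (Fin 2) (Fin 2) ℂ) i j)
      =ᵐ[haar] fun v => c' v * (κ' v : Matrix (Fin 2) (Fin 2) ℂ) i j := fun i j =>
    ae_eq_of_forall_integral_mul_continuous (hint i j h.1 h.2.1) (hint i j h'.1 h'.2.1)
      fun f hf => by
        have hF : Continuous fun p : SU2 × SU2 =>
            (p.2 : Matrix (Fin 2) (Fin 2) ℂ) i j * f p.1 :=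
          ((continuous_entry i j).comp continuous_snd).mul (hf.comp continuous_fst)
        simp only [mul_assoc]
        rw [← h.2.2 (fun v u => (u : Matrix (Fin 2) (Fin 2) ℂ) i j * f v) hF,
          ← h'.2.2 (fun v u => (u : Matrix (Fin 2) (Fin 2) ℂ) i j * f v) hF]
  refine ⟨h1, ?_⟩
  have h3 : ∀ᵐ v ∂haar, ∀ i j, c v * (κ v : Matrix (Fin 2) (Fin 2) ℂ) i j
      = c' v * (κ' v : Matrix (Fin 2) (Fin 2) ℂ) i j :=
    ae_all_iff.mpr fun i => ae_all_iff.mpr fun j => h2 i j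
  filter_upwards [h1, h3] with v hv1 hv3
  refine Subtype.ext (Matrix.ext fun i j => mul_left_cancel₀ (hc' v) ?_)
  rw [← hv3 i j, hv1]

/-- On almost every conjugacy class every symbol of the Wilson loop takes the expected values. -/
theorem HasSymbol.ae_conj_g {μ : ℝ} {k : ℤ} {c : SU2 → ℂ} {κ : SU2 → SU2}
    (h : HasSymbol (wilsonLoop (loopDensity k) μ k) c κ) :
    ∀ᵐ θ, θ ∈ Ioo 0 (2 * Real.pi) → ∀ᵐ z ∂haar,
      c (z * g θ * z⁻¹) = loopPhase μ k θ ∧ κ (z * g θ * z⁻¹) = z * g μ * z⁻¹ := by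
  have hne : ∀ v, loopCoeff μ k v ≠ 0 := fun v => by
    rw [← norm_ne_zero_iff, loopCoeff, norm_loopPhase]; exact one_ne_zero
  obtain ⟨h1, h2⟩ := h.ae_eq (hasSymbol_wilsonLoop μ k) hne
  filter_upwards [ae_ae_conj_g (h1.and h2)] with θ hθ hmem
  filter_upwards [hθ hmem] with z hz
  rw [hz.1, hz.2, loopCoeff_conj_g μ k z hmem, rotate_conj_g μ z hmem]
  exact ⟨rfl, rfl⟩

/-! ### Unitary operators on the gauge invariant Hilbert space -/

/-- The torus on which gauge invariant states live. -/
abbrev Torus2Pi : Type := Circle2Pi × Circle2Pi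

instance : (volume : Measure Torus2Pi).IsAddRightInvariant :=
  inferInstanceAs
    ((volume : Measure Circle2Pi).prod (volume : Measure Circle2Pi)).IsAddRightInvariant

theorem memLp_phase_mul_translate {m : Torus2Pi → ℂ} (hm : Measurable m) (hm1 : ∀ x, ‖m x‖ = 1)
    (t : Torus2Pi) (ψ : Hinv) : MemLp (fun x => m x * ψ (x + t)) 2 volume := by
  have h : MemLp (fun x => ψ (x + t)) 2 volume :=
    (Lp.memLp ψ).comp_measurePreserving (measurePreserving_add_right volume t)
  refine MemLp.of_le h (hm.aestronglyMeasurable.mul h.aestronglyMeasurable)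
    (Filter.Eventually.of_forall fun x => ?_)
  rw [norm_mul, hm1, one_mul]

/-- The isometry `ψ ↦ m · ψ(· + t)` of the gauge invariant Hilbert space, for a measurable function
`m` with values of modulus one. -/
noncomputable def phaseTranslation (m : Torus2Pi → ℂ) (hm : Measurable m) (hm1 : ∀ x, ‖m x‖ = 1)
    (t : Torus2Pi) : Hinv →ₗᵢ[ℂ] Hinv where
  toFun ψ := (memLp_phase_mul_translate hm hm1 t ψ).toLp _
  map_add' φ ψ := by
    rw [← MemLp.toLp_add]
    refine MemLp.toLp_congr _ _ ?_
    filter_upwards [(measurePreserving_add_right volume t).quasiMeasurePreserving.ae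
      (Lp.coeFn_add φ ψ)] with x hx
    rw [hx, Pi.add_apply, Pi.add_apply, mul_add]
  map_smul' c ψ := by
    rw [RingHom.id_apply, ← MemLp.toLp_const_smul]
    refine MemLp.toLp_congr _ _ ?_
    filter_upwards [(measurePreserving_add_right volume t).quasiMeasurePreserving.ae
      (Lp.coeFn_smul c ψ)] with x hx
    rw [hx, Pi.smul_apply, Pi.smul_apply, smul_eq_mul, smul_eq_mul, mul_left_comm]
  norm_map' ψ := by
    change ‖(memLp_phase_mul_translate hm hm1 t ψ).toLp _‖ = ‖ψ‖
    rw [Lp.norm_toLp, Lp.norm_def]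
    congr 1
    have h : AEStronglyMeasurable (ψ : Torus2Pi → ℂ) volume := Lp.aestronglyMeasurable ψ
    rw [← eLpNorm_comp_measurePreserving h (measurePreserving_add_right volume t)]
    refine eLpNorm_congr_norm_ae (Filter.Eventually.of_forall fun x => ?_)
    rw [norm_mul, hm1, one_mul, Function.comp]

theorem coeFn_phaseTranslation {m : Torus2Pi → ℂ} (hm : Measurable m) (hm1 : ∀ x, ‖m x‖ = 1)
    (t : Torus2Pi) (ψ : Hinv) :
    (phaseTranslation m hm hm1 t ψ : Torus2Pi → ℂ) =ᵐ[volume] fun x => m x * ψ (x + t) :=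
  MemLp.coeFn_toLp (memLp_phase_mul_translate hm hm1 t ψ)

theorem phaseTranslation_comp {m m' : Torus2Pi → ℂ} (hm : Measurable m) (hm1 : ∀ x, ‖m x‖ = 1)
    (hm' : Measurable m') (hm1' : ∀ x, ‖m' x‖ = 1) {t t' : Torus2Pi} (ht : t + t' = 0)
    (hmm : ∀ x, m x * m' (x + t) = 1) (ψ : Hinv) :
    phaseTranslation m hm hm1 t (phaseTranslation m' hm' hm1' t' ψ) = ψ := by
  refine Lp.ext ?_
  filter_upwards [coeFn_phaseTranslation hm hm1 t (phaseTranslation m' hm' hm1' t' ψ),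
    (measurePreserving_add_right volume t).quasiMeasurePreserving.ae
      (coeFn_phaseTranslation hm' hm1' t' ψ)] with x h1 h2
  rw [h1, h2, ← mul_assoc, hmm, add_assoc, ht, add_zero, one_mul]

theorem IsSingular.conj {μ : ℝ} : IsSingular (2 * Real.pi - μ) ↔ IsSingular μ := by
  constructor
  · rintro ⟨m, hm⟩
    exact ⟨1 - m, by push_cast; linarith⟩
  · rintro ⟨m, hm⟩
    exact ⟨1 - m, by push_cast; linarith⟩

/-- The `2π`-periodic function that agrees with `loopPhase μ k` on `[0, 2π)`. -/
noncomputable def circlePhase (μ : ℝ) (k : ℤ) (x : Circle2Pi) : ℂ :=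
  loopPhase μ k (AddCircle.equivIco (2 * Real.pi) 0 x)

theorem measurable_circlePhase (μ : ℝ) (k : ℤ) : Measurable (circlePhase μ k) :=
  (continuous_loopPhase μ k).measurable.comp
    (measurable_subtype_coe.comp (AddCircle.measurableEquivIco (2 * Real.pi) 0).measurable)

theorem norm_circlePhase (μ : ℝ) (k : ℤ) (x : Circle2Pi) : ‖circlePhase μ k x‖ = 1 :=
  norm_loopPhase μ k _

theorem circlePhase_coe (μ : ℝ) (k : ℤ) {θ : ℝ} (hθ : θ ∈ Ico 0 (2 * Real.pi)) :
    circlePhase μ k (θ : Circle2Pi) = loopPhase μ k θ := by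
  have h : (AddCircle.equivIco (2 * Real.pi) 0 (θ : Circle2Pi) : ℝ) = θ := by
    rw [AddCircle.coe_equivIco_mk_apply,
      Int.fract_eq_self.mpr ⟨div_nonneg hθ.1 Real.two_pi_pos.le,
        (div_lt_one Real.two_pi_pos).mpr hθ.2⟩, div_mul_cancel₀ _ Real.two_pi_pos.ne']
  rw [circlePhase, h]

theorem circlePhase_of_isSingular {μ : ℝ} (hμ : IsSingular μ) (k : ℤ) (x : Circle2Pi) :
    circlePhase μ k x = 1 := if_pos hμ

theorem circlePhase_mul_conj (μ : ℝ) (k : ℤ) (x : Circle2Pi) :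
    circlePhase μ k x * circlePhase (2 * Real.pi - μ) (-k) x = 1 := by
  rw [circlePhase, circlePhase, loopPhase, loopPhase]
  by_cases hμ : IsSingular μ
  · rw [if_pos hμ, if_pos (IsSingular.conj.mpr hμ), one_mul]
  · rw [if_neg hμ, if_neg (mt IsSingular.conj.mp hμ), ← Complex.exp_add, ← Complex.exp_zero]
    congr 1
    push_cast
    ring

namespace WilsonLabel

/-- The coordinate of the torus on which the phase of the Wilson loop depends. -/
def phaseVar (X : TorusCycle) (x : Torus2Pi) : Circle2Pi :=
  match X with
  | TorusCycle.A => x.1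
  | TorusCycle.B => x.2

/-- The translation of the torus by which the Wilson loop acts. -/
noncomputable def shift (X : TorusCycle) (μ : ℝ) : Torus2Pi :=
  match X with
  | TorusCycle.A => (0, ((-μ : ℝ) : Circle2Pi))
  | TorusCycle.B => ((μ : Circle2Pi), 0)

theorem measurable_phaseVar (X : TorusCycle) : Measurable (phaseVar X) := by
  cases X
  · exact measurable_fst
  · exact measurable_snd

theorem phaseVar_add_shift (X : TorusCycle) (μ : ℝ) (x : Torus2Pi) :
    phaseVar X (x + shift X μ) = phaseVar X x := by
  cases X <;> simp [phaseVar, shift]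

theorem shift_add_shift_conj (X : TorusCycle) (μ : ℝ) :
    shift X μ + shift X (2 * Real.pi - μ) = 0 := by
  have h : ((2 * Real.pi : ℝ) : Circle2Pi) = 0 := AddCircle.coe_period _
  cases X <;> ext <;> simp [shift, h]

/-- The operator by which the Wilson loop with label `l` acts on the gauge invariant Hilbert space:
a translation followed by multiplication with a phase. -/
noncomputable def isometry (l : WilsonLabel) : Hinv →ₗᵢ[ℂ] Hinv :=
  phaseTranslation (fun x => circlePhase l.μ l.twoS (phaseVar l.X x))
    ((measurable_circlePhase _ _).comp (measurable_phaseVar _)) (fun _ => norm_circlePhase _ _ _)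
    (shift l.X l.μ)

theorem coeFn_isometry (l : WilsonLabel) (ψ : Hinv) :
    (l.isometry ψ : Torus2Pi → ℂ) =ᵐ[volume]
      fun x => circlePhase l.μ l.twoS (phaseVar l.X x) * ψ (x + shift l.X l.μ) :=
  coeFn_phaseTranslation _ _ _ ψ

theorem isometry_conj_apply (l : WilsonLabel) (ψ : Hinv) : l.isometry (l.conj.isometry ψ) = ψ :=
  phaseTranslation_comp _ _ _ _ (shift_add_shift_conj _ _)
    (fun x => by
      change _ * circlePhase (2 * Real.pi - l.μ) (-l.twoS) (phaseVar l.X (x + shift l.X l.μ)) = 1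
      rw [phaseVar_add_shift, circlePhase_mul_conj]) ψ

/-- The operator of the Wilson loop with label `l`. -/
noncomputable def op (l : WilsonLabel) : Hinv →L[ℂ] Hinv := l.isometry.toContinuousLinearMap

theorem inner_op_conj (l : WilsonLabel) (φ ψ : Hinv) :
    inner ℂ (l.conj.op φ) ψ = inner ℂ φ (l.op ψ) := by
  have h := l.isometry.inner_map_map (l.conj.isometry φ) ψ
  rw [isometry_conj_apply] at h
  exact h.symm

theorem star_op (l : WilsonLabel) : star l.op = l.conj.op := by
  rw [ContinuousLinearMap.star_eq_adjoint, eq_comm, ContinuousLinearMap.eq_adjoint_iff]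
  exact inner_op_conj l

theorem op_mul_op_conj (l : WilsonLabel) : l.op * l.conj.op = 1 :=
  ContinuousLinearMap.ext fun ψ => isometry_conj_apply l ψ

theorem op_mem_unitary (l : WilsonLabel) : l.op ∈ unitary (Hinv →L[ℂ] Hinv) := by
  rw [Unitary.mem_iff, star_op]
  refine ⟨?_, op_mul_op_conj l⟩
  have := op_mul_op_conj l.conj
  rwa [conj_conj] at this

end WilsonLabel

/-- The representation of the algebra of Wilson loops. -/
noncomputable def wilsonRep : WilsonAlgebra →⋆ₐ[ℂ] (Hinv →L[ℂ] Hinv) :=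
  let f : WilsonAlgebra →ₐ[ℂ] (Hinv →L[ℂ] Hinv) :=
    MonoidAlgebra.lift ℂ (Hinv →L[ℂ] Hinv) (FreeMonoid WilsonLabel) (FreeMonoid.lift WilsonLabel.op)
  have hW : ∀ l, f (WilsonAlgebra.W l) = l.op := fun l => by simp [f, WilsonAlgebra.W]
  { f with
    map_star' := fun a => by
      change f (star a) = star (f a)
      induction a using WilsonAlgebra.induction with
      | h1 => simp
      | hW l => rw [WilsonAlgebra.star_W, hW, hW, WilsonLabel.star_op]
      | hadd a b ha hb => simp [ha, hb]
      | hmul a b ha hb => simp [ha, hb]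
      | hsmul c a ha => simp [ha] }

theorem wilsonRep_W (l : WilsonLabel) : wilsonRep (WilsonAlgebra.W l) = l.op := by
  change MonoidAlgebra.lift ℂ (Hinv →L[ℂ] Hinv) (FreeMonoid WilsonLabel)
    (FreeMonoid.lift WilsonLabel.op) (WilsonAlgebra.W l) = l.op
  simp [WilsonAlgebra.W]

/-! ### The torus and its universal cover -/

theorem setIntegral_preimage_of_measurePreserving {X Y E : Type*} [MeasurableSpace X]
    [MeasurableSpace Y] [NormedAddCommGroup E] [NormedSpace ℝ E] {μ : Measure X} {ν : Measure Y}
    {f : X → Y} (hf : MeasurePreserving f μ ν) {s : Set Y} (hs : MeasurableSet s) {F : Y → E}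
    (hF : AEStronglyMeasurable F ν) : ∫ x in f ⁻¹' s, F (f x) ∂μ = ∫ y in s, F y ∂ν := by
  obtain ⟨hm, rfl⟩ := hf
  exact (setIntegral_map hs hF hm.aemeasurable).symm

/-- The covering of the torus by the plane. -/
noncomputable def torusMk (p : ℝ × ℝ) : Torus2Pi := ((p.1 : Circle2Pi), (p.2 : Circle2Pi))

theorem quasiMeasurePreserving_circle_mk :
    Measure.QuasiMeasurePreserving (fun x : ℝ => (x : Circle2Pi)) volume volume := by
  refine ⟨AddCircle.measurable_mk', Measure.AbsolutelyContinuous.mk fun s hs h0 => ?_⟩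
  rw [Measure.map_apply (f := fun x : ℝ => (x : Circle2Pi)) AddCircle.measurable_mk' hs]
  have h : ∀ᵐ x : ℝ ∂volume.restrict
      (⋃ n : ℤ, Ioc (0 + n • (2 * Real.pi)) (0 + (n + 1) • (2 * Real.pi))),
      (x : Circle2Pi) ∉ s := by
    rw [ae_restrict_iUnion_iff]
    intro n
    have := (AddCircle.measurePreserving_mk (2 * Real.pi)
      (0 + n • (2 * Real.pi))).quasiMeasurePreserving.ae (measure_eq_zero_iff_ae_notMem.mp h0)
    rwa [add_assoc, ← add_one_zsmul] at this
  rw [iUnion_Ioc_add_zsmul Real.two_pi_pos, Measure.restrict_univ] at h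
  exact measure_eq_zero_iff_ae_notMem.mpr h

theorem quasiMeasurePreserving_torusMk : Measure.QuasiMeasurePreserving torusMk volume volume :=
  MeasureTheory.QuasiMeasurePreserving.prodMap quasiMeasurePreserving_circle_mk
    quasiMeasurePreserving_circle_mk

/-- The open square `(0, 2π)²` is a fundamental domain of the covering up to a null set. -/
theorem measurePreserving_torusMk : MeasurePreserving torusMk
    (volume.restrict (Ioo 0 (2 * Real.pi) ×ˢ Ioo 0 (2 * Real.pi))) volume := by
  have h := AddCircle.measurePreserving_mk (2 * Real.pi) 0
  rw [zero_add, ← Measure.restrict_congr_set Ioo_ae_eq_Ioc] at h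
  have h2 := h.prod h
  rw [Measure.prod_restrict] at h2
  exact h2

/-- The change of variables `(α, β) ↦ (α + β, α)` between the labels of `χ_{α,β}` and the arguments
of the coefficient function. -/
def skew (p : ℝ × ℝ) : ℝ × ℝ := (p.1 + p.2, p.1)

theorem measurePreserving_skew : MeasurePreserving skew :=
  Measure.measurePreserving_swap.comp
    (measurePreserving_prod_add (volume : Measure ℝ) (volume : Measure ℝ))

/-- The vector of the translation `displace X μ`. -/
def displacement (X : TorusCycle) (μ : ℝ) : ℝ × ℝ :=
  match X with
  | TorusCycle.A => (μ, -μ)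
  | TorusCycle.B => (0, -μ)

theorem displace_eq (X : TorusCycle) (μ : ℝ) :
    displace X μ = fun p => p + displacement X μ := by
  cases X <;> funext p <;> simp [displace, displacement, sub_eq_add_neg, Prod.ext_iff]

theorem measurePreserving_displace (X : TorusCycle) (μ : ℝ) : MeasurePreserving (displace X μ) := by
  rw [displace_eq]
  exact measurePreserving_add_right volume (displacement X μ)

theorem measurableEmbedding_displace (X : TorusCycle) (μ : ℝ) :
    MeasurableEmbedding (displace X μ) := by
  rw [displace_eq]
  exact measurableEmbedding_addRight _

theorem displace_surjective (X : TorusCycle) (μ : ℝ) : Function.Surjective (displace X μ) := by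
  rw [displace_eq]
  exact (Equiv.addRight (displacement X μ)).surjective

theorem isBounded_preimage_skew_displace (X : TorusCycle) (μ : ℝ) :
    Bornology.IsBounded ((fun p => skew (displace X μ p)) ⁻¹'
      (Ioo 0 (2 * Real.pi) ×ˢ Ioo 0 (2 * Real.pi))) := by
  refine (Metric.isBounded_Icc (-(|μ| + 2 * Real.pi), -(|μ| + 2 * Real.pi))
    (|μ| + 2 * Real.pi, |μ| + 2 * Real.pi)).subset fun p hp => ?_
  obtain ⟨⟨h1, h2⟩, h3, h4⟩ := hp
  have h5 := le_abs_self μ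
  have h6 := neg_abs_le μ
  cases X <;> simp only [skew, displace] at h1 h2 h3 h4 <;>
    refine ⟨⟨?_, ?_⟩, ?_, ?_⟩ <;> simp only <;> linarith [Real.pi_pos]

/-! ### The action of Wilson loops on coefficient functions -/

theorem conj_g_mul_conj_g (z : SU2) (s t : ℝ) :
    z * g s * z⁻¹ * (z * g t * z⁻¹) = z * g (s + t) * z⁻¹ := by
  rw [g_add]; group

theorem inv_conj_g (z : SU2) (t : ℝ) : (z * g t * z⁻¹)⁻¹ = z * g (-t) * z⁻¹ := by
  rw [g_neg]; group

/-- If the symbol takes the expected values on almost every conjugacy class, the graph algebra acts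
on kinematical states as the operator of the Wilson loop acts on coefficient functions. -/
theorem graphAction_stateOn (l : WilsonLabel) {c : SU2 → ℂ} {κ : SU2 → SU2}
    (hcκ : ∀ᵐ θ, θ ∈ Ioo 0 (2 * Real.pi) → ∀ᵐ z ∂haar,
      c (z * g θ * z⁻¹) = loopPhase l.μ l.twoS θ ∧ κ (z * g θ * z⁻¹) = z * g l.μ * z⁻¹)
    (ψ : Hinv) {D : Set (ℝ × ℝ)} (hD : MeasurableSet D) (hDp : D ⊆ principal l.X)
    (h : SU2 → SU2 → ℂ) :
    graphAction l.X c κ (stateOn D ψ) h = stateOn (displace l.X l.μ '' D) (l.op ψ) h := by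
  obtain ⟨X, μ, k⟩ := l
  have hop : ∀ᵐ p : ℝ × ℝ, WilsonLabel.op ⟨X, μ, k⟩ ψ (torusMk (skew (displace X μ p)))
      = circlePhase μ k (WilsonLabel.phaseVar X (torusMk (skew (displace X μ p))))
        * ψ (torusMk (skew (displace X μ p)) + WilsonLabel.shift X μ) :=
    ((quasiMeasurePreserving_torusMk.comp measurePreserving_skew.quasiMeasurePreserving).comp
      (measurePreserving_displace X μ).quasiMeasurePreserving).ae
      (WilsonLabel.coeFn_isometry ⟨X, μ, k⟩ ψ)
  cases X with
  | A =>
    have hsum : ∀ᵐ p : ℝ × ℝ, p.1 + p.2 ∈ Ioo 0 (2 * Real.pi) → ∀ᵐ z ∂haar,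
        c (z * g (p.1 + p.2) * z⁻¹) = loopPhase μ k (p.1 + p.2)
          ∧ κ (z * g (p.1 + p.2) * z⁻¹) = z * g μ * z⁻¹ :=
      (Measure.quasiMeasurePreserving_fst.comp
        measurePreserving_skew.quasiMeasurePreserving).ae hcκ
    simp only [graphAction, stateOn]
    rw [(measurePreserving_displace _ μ).setIntegral_image_emb (measurableEmbedding_displace _ μ)]
    refine setIntegral_congr_ae hD ?_
    filter_upwards [hop, hsum] with p hp1 hp2 hpD
    have hmem : p.1 + p.2 ∈ Ioo 0 (2 * Real.pi) := hDp hpD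
    have hchi : chi p.1 p.2 (fun a b => c (a * b) * h (κ (a * b) * a) (b * (κ (a * b))⁻¹))
        = loopPhase μ k (p.1 + p.2) * chi (p.1 + μ) (p.2 - μ) h := by
      rw [chi, chi, ← integral_const_mul]
      refine integral_congr_ae ?_
      filter_upwards [hp2 hmem] with z hz
      rw [conj_g_mul_conj_g, hz.1, hz.2, inv_conj_g, conj_g_mul_conj_g, conj_g_mul_conj_g,
        add_comm μ, sub_eq_add_neg]
    have hval : (WilsonLabel.op ⟨TorusCycle.A, μ, k⟩ ψ).val (p.1 + μ + (p.2 - μ)) (p.1 + μ)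
        = loopPhase μ k (p.1 + p.2) * ψ.val (p.1 + p.2) p.1 := by
      have h1 : p.1 + μ + (p.2 - μ) = p.1 + p.2 := by ring
      have h2 : torusMk (skew (displace TorusCycle.A μ p))
          = (((p.1 + p.2 : ℝ) : Circle2Pi), ((p.1 + μ : ℝ) : Circle2Pi)) := by
        simp only [torusMk, skew, displace, h1]
      have h3 : (((p.1 + p.2 : ℝ) : Circle2Pi), ((p.1 + μ : ℝ) : Circle2Pi))
          + WilsonLabel.shift TorusCycle.A μ
          = (((p.1 + p.2 : ℝ) : Circle2Pi), (p.1 : Circle2Pi)) := by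
        simp [WilsonLabel.shift]
      rw [h2, h3] at hp1
      rw [Hinv.val, h1, hp1, ← circlePhase_coe μ k (Ioo_subset_Ico_self hmem)]
      rfl
    change _ = (WilsonLabel.op ⟨TorusCycle.A, μ, k⟩ ψ).val (p.1 + μ + (p.2 - μ)) (p.1 + μ)
      * chi (p.1 + μ) (p.2 - μ) h
    rw [hchi, hval]
    ring
  | B =>
    have hfst : ∀ᵐ p : ℝ × ℝ, p.1 ∈ Ioo 0 (2 * Real.pi) → ∀ᵐ z ∂haar,
        c (z * g p.1 * z⁻¹) = loopPhase μ k p.1 ∧ κ (z * g p.1 * z⁻¹) = z * g μ * z⁻¹ :=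
      Measure.quasiMeasurePreserving_fst.ae hcκ
    simp only [graphAction, stateOn]
    rw [(measurePreserving_displace _ μ).setIntegral_image_emb (measurableEmbedding_displace _ μ)]
    refine setIntegral_congr_ae hD ?_
    filter_upwards [hop, hfst] with p hp1 hp2 hpD
    have hmem : p.1 ∈ Ioo 0 (2 * Real.pi) := hDp hpD
    have hchi : chi p.1 p.2 (fun a b => c (b⁻¹ * a * b) * h a (b * (κ (b⁻¹ * a * b))⁻¹))
        = loopPhase μ k p.1 * chi p.1 (p.2 - μ) h := by
      rw [chi, chi, ← integral_const_mul]
      refine integral_congr_ae ?_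
      filter_upwards [hp2 hmem] with z hz
      rw [inv_conj_g, conj_g_mul_conj_g, conj_g_mul_conj_g, neg_add_cancel_comm, hz.1, hz.2,
        inv_conj_g, conj_g_mul_conj_g, sub_eq_add_neg]
    have hval : (WilsonLabel.op ⟨TorusCycle.B, μ, k⟩ ψ).val (p.1 + (p.2 - μ)) p.1
        = loopPhase μ k p.1 * ψ.val (p.1 + p.2) p.1 := by
      have h3 : torusMk (skew (displace TorusCycle.B μ p)) + WilsonLabel.shift TorusCycle.B μ
          = (((p.1 + p.2 : ℝ) : Circle2Pi), (p.1 : Circle2Pi)) := by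
        simp only [WilsonLabel.shift, torusMk, skew, displace, Prod.mk_add_mk, add_zero,
          ← AddCircle.coe_add]
        congr 2
        ring
      rw [h3] at hp1
      rw [← circlePhase_coe μ k (Ioo_subset_Ico_self hmem)]
      exact hp1
    change _ = (WilsonLabel.op ⟨TorusCycle.B, μ, k⟩ ψ).val (p.1 + (p.2 - μ)) p.1
      * chi p.1 (p.2 - μ) h
    rw [hchi, hval]
    ring

/-- A coefficient function is determined by the total weights `∫ ψ(α+β, α) dα dβ` over the displaced
pieces of the principal range: these pieces cover the torus. -/
theorem Hinv.ext_of_stateOn (X : TorusCycle) (μ : ℝ) {φ ψ : Hinv}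
    (h : ∀ D : Set (ℝ × ℝ), MeasurableSet D → Bornology.IsBounded D → D ⊆ principal X →
      stateOn (displace X μ '' D) φ (fun _ _ => 1) = stateOn (displace X μ '' D) ψ (fun _ _ => 1)) :
    φ = ψ := by
  set Q : Set (ℝ × ℝ) := Ioo 0 (2 * Real.pi) ×ˢ Ioo 0 (2 * Real.pi) with hQ
  have hQm : MeasurableSet Q := measurableSet_Ioo.prod measurableSet_Ioo
  have hmp : MeasurePreserving (fun p => torusMk (skew p)) (volume.restrict (skew ⁻¹' Q)) volume :=
    measurePreserving_torusMk.comp (measurePreserving_skew.restrict_preimage hQm)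
  have hint : ∀ χ : Hinv, Integrable χ volume := fun χ => (Lp.memLp χ).integrable one_le_two
  -- The piece of the expansion lying over `s` has the total weight `∫ x in s, χ x`, as `χ_{α,β}`
  -- pairs with the constant function `1` to `1`.
  have hstate : ∀ (χ : Hinv) {s : Set Torus2Pi}, MeasurableSet s →
      stateOn ((fun p => torusMk (skew p)) ⁻¹' s ∩ skew ⁻¹' Q) χ (fun _ _ => 1)
        = ∫ x in s, χ x := fun χ s hs => by
    rw [← setIntegral_preimage_of_measurePreserving hmp hs (hint χ).aestronglyMeasurable,
      Measure.restrict_restrict (hmp.measurable hs), stateOn]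
    refine integral_congr_ae (Filter.Eventually.of_forall fun p => ?_)
    simp [chi, Hinv.val, torusMk, skew]
  refine Lp.ext ((hint φ).ae_eq_of_forall_setIntegral_eq _ _ (hint ψ) fun s hs _ => ?_)
  rw [← hstate φ hs, ← hstate ψ hs,
    ← image_preimage_eq ((fun p => torusMk (skew p)) ⁻¹' s ∩ skew ⁻¹' Q) (displace_surjective X μ)]
  refine h _ ?_ ?_ ?_
  · exact (measurePreserving_displace X μ).measurable
      ((hmp.measurable hs).inter (measurePreserving_skew.measurable hQm))
  · exact (isBounded_preimage_skew_displace X μ).subset fun p hp => hp.2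
  · rintro p ⟨_, h1, h2⟩
    cases X with
    | A =>
      have h3 : p.1 + μ + (p.2 - μ) ∈ Ioo 0 (2 * Real.pi) := h1
      rwa [add_add_sub_cancel] at h3
    | B => exact h2

/-- The operator of the Wilson loop is its unique action on the gauge invariant Hilbert space. -/
theorem isWilsonAction_iff (l : WilsonLabel) (T : Hinv →L[ℂ] Hinv) :
    IsWilsonAction (loopDensity l.twoS) l T ↔ T = l.op := by
  constructor
  · rintro ⟨c, κ, hsym, hact⟩
    refine ContinuousLinearMap.ext fun ψ => Hinv.ext_of_stateOn l.X l.μ fun D hD hDb hDp => ?_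
    rw [← hact ψ D hD hDb hDp (fun _ _ => 1) continuous_const,
      graphAction_stateOn l hsym.ae_conj_g ψ hD hDp]
  · rintro rfl
    exact ⟨_, _, hasSymbol_wilsonLoop l.μ l.twoS, fun ψ D hD _ hDp h _ =>
      graphAction_stateOn l (hasSymbol_wilsonLoop l.μ l.twoS).ae_conj_g ψ hD hDp h⟩

theorem ae_val_op_A (μ : ℝ) (k : ℤ) (ψ : Hinv) :
    ∀ᵐ p : ℝ × ℝ, (WilsonLabel.op ⟨TorusCycle.A, μ, k⟩ ψ).val p.1 p.2
      = circlePhase μ k (p.1 : Circle2Pi) * ψ.val p.1 (p.2 - μ) := by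
  filter_upwards [quasiMeasurePreserving_torusMk.ae
    (WilsonLabel.coeFn_isometry ⟨TorusCycle.A, μ, k⟩ ψ)] with p hp
  have h : torusMk p + WilsonLabel.shift TorusCycle.A μ
      = ((p.1 : Circle2Pi), ((p.2 - μ : ℝ) : Circle2Pi)) := by
    simp [torusMk, WilsonLabel.shift, sub_eq_add_neg]
  rw [h] at hp
  exact hp

theorem ae_val_op_B (μ : ℝ) (k : ℤ) (ψ : Hinv) :
    ∀ᵐ p : ℝ × ℝ, (WilsonLabel.op ⟨TorusCycle.B, μ, k⟩ ψ).val p.1 p.2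
      = circlePhase μ k (p.2 : Circle2Pi) * ψ.val (p.1 + μ) p.2 := by
  filter_upwards [quasiMeasurePreserving_torusMk.ae
    (WilsonLabel.coeFn_isometry ⟨TorusCycle.B, μ, k⟩ ψ)] with p hp
  have h : torusMk p + WilsonLabel.shift TorusCycle.B μ
      = (((p.1 + μ : ℝ) : Circle2Pi), (p.2 : Circle2Pi)) := by
    simp [torusMk, WilsonLabel.shift]
  rw [h] at hp
  exact hp

theorem mainTheorem1 :
    ∃ M : ℤ → SU2 → SU2 → ℝ,
      (∀ k, Measurable fun p : SU2 × SU2 => M k p.1 p.2) ∧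
      (∀ k x u v, M k (x⁻¹ * u * x) (x⁻¹ * v * x) = M k u v) ∧
      (∀ μ, ¬ IsSingular μ → ∀ k k' v, M k (SU2.g μ) v = M k' (SU2.g μ) v) ∧
      ∃ rep : WilsonAlgebra →⋆ₐ[ℂ] (Hinv →L[ℂ] Hinv),
        (∀ l : WilsonLabel, ∀ T : Hinv →L[ℂ] Hinv,
          IsWilsonAction (M l.twoS) l T ↔ T = rep (WilsonAlgebra.W l)) ∧
        (∀ (l : WilsonLabel) (φ ψ : Hinv), inner ℂ (rep (WilsonAlgebra.W l.conj) φ) ψ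
          = inner ℂ φ (rep (WilsonAlgebra.W l) ψ)) ∧
        (∀ l : WilsonLabel, rep (WilsonAlgebra.W l) ∈ unitary (Hinv →L[ℂ] Hinv)) ∧
        (∀ (μ : ℝ) (k : ℤ) (ψ : Hinv), ¬ IsSingular μ →
          (∀ᵐ p : ℝ × ℝ, p.1 ∈ Ico 0 (2 * Real.pi) →
            (rep (WilsonAlgebra.W ⟨TorusCycle.A, μ, k⟩) ψ).val p.1 p.2
              = Complex.exp (Complex.I * ((k : ℝ) / 2 : ℝ) * p.1) * ψ.val p.1 (p.2 - μ)) ∧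
          (∀ᵐ p : ℝ × ℝ, p.2 ∈ Ico 0 (2 * Real.pi) →
            (rep (WilsonAlgebra.W ⟨TorusCycle.B, μ, k⟩) ψ).val p.1 p.2
              = Complex.exp (Complex.I * ((k : ℝ) / 2 : ℝ) * p.2) * ψ.val (p.1 + μ) p.2)) ∧
        (∀ (μ : ℝ) (k : ℤ) (ψ : Hinv), IsSingular μ →
          (∀ᵐ p : ℝ × ℝ,
            (rep (WilsonAlgebra.W ⟨TorusCycle.A, μ, k⟩) ψ).val p.1 p.2 = ψ.val p.1 (p.2 - μ)) ∧
          (∀ᵐ p : ℝ × ℝ,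
            (rep (WilsonAlgebra.W ⟨TorusCycle.B, μ, k⟩) ψ).val p.1 p.2 = ψ.val (p.1 + μ) p.2)) := by
  refine ⟨loopDensity, measurable_loopDensity, loopDensity_conj, fun μ hμ k k' v => ?_, wilsonRep,
    fun l T => ?_, fun l φ ψ => ?_, fun l => ?_, fun μ k ψ hμ => ⟨?_, ?_⟩,
    fun μ k ψ hμ => ⟨?_, ?_⟩⟩
  · rw [loopDensity_of_not_isSingular k hμ, loopDensity_of_not_isSingular k' hμ]
  · rw [wilsonRep_W, isWilsonAction_iff]
  · rw [wilsonRep_W, wilsonRep_W, WilsonLabel.inner_op_conj]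
  · rw [wilsonRep_W]; exact l.op_mem_unitary
  · filter_upwards [ae_val_op_A μ k ψ] with p hp hmem
    rw [wilsonRep_W, hp, circlePhase_coe μ k hmem, loopPhase, if_neg hμ]
  · filter_upwards [ae_val_op_B μ k ψ] with p hp hmem
    rw [wilsonRep_W, hp, circlePhase_coe μ k hmem, loopPhase, if_neg hμ]
  · filter_upwards [ae_val_op_A μ k ψ] with p hp
    rw [wilsonRep_W, hp, circlePhase_of_isSingular hμ, one_mul]
  · filter_upwards [ae_val_op_B μ k ψ] with p hp
    rw [wilsonRep_W, hp, circlePhase_of_isSingular hμ, one_mul]
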